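/- Let $k_0$ be a perfect field of characteristic $p>0$, let $V$ be an integral scheme which is quasi-projective and smooth over $k_0$, and let $K$ be its function field. For a scheme $S$ of characteristic $p$, write $F_S$ for its absolute Frobenius endomorphism. Write $K^{[1]}$ for the field $K$ viewed as a $k_0$-algebra through $k_0\xrightarrow{x\mapsto x^p}k_0\to K$, and $\Omega_{F_K}$ for the module of differentials of $F_K:\mathrm{Spec}\,K\to\mathrm{Spec}\,K$; the natural map $\Omega_{K^{[1]}/k_0}\to\Omega_{F_K}$ is an isomorphism. A group scheme $\Gamma$ over $S$ is *of height one* if it is finite and flat over $S$ and its relative Frobenius $\Gamma\to\Gamma^{(p)}$ is the zero homomorphism; an isogeny of semiabelian schemes is of height one if its kernel is. Write $\omega_\Gamma=\epsilon^*\Omega_{\Gamma/S}$, where $\epsilon$ is the zero section. If $\Gamma$ is a commutative group scheme of height one over $K$, let $H^1(K,\Gamma)$ be the set of isomorphism classes of torsors under $\Gamma$ over $\mathrm{Spec}\,K$. For such a torsor $\lambda:P\to\mathrm{Spec}\,K$ there is a unique $\sigma:\mathrm{Spec}\,K\to P$ with $\lambda\circ\sigma=F_K$. The trivialisation $\gamma\mapsto\gamma\cdot\sigma$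 of $F_K^*P$ gives an isomorphism $\sigma^*\Omega_{P/K}\simeq F_K^*\omega_\Gamma$, and $$\Phi_\Gamma(P):F_K^*\omega_\Gamma\simeq\sigma^*\Omega_{P/K}\longrightarrow\Omega_{F_K}\simeq\Omega_{K^{[1]}/k_0}$$ is the $K$-linear map given by the differential of $\sigma$. It depends only on the class of $P$ in $H^1(K,\Gamma)$. Let $$\begin{array}{ccc}\mathcal A&\xrightarrow{\ \iota\ }&\mathcal B\\ {\scriptstyle a}\downarrow&&\downarrow{\scriptstyle b}\\ \mathcal A_1&\xrightarrow{\ \iota_1\ }&\mathcal B_1\end{array}$$ be a commutative square of semiabelian schemes over $V$ and homomorphisms of group schemes, where $\iota$ and $\iota_1$ are isogenies of height one. Then: 1. $a(\ker\iota)\subseteq\ker\iota_1$; that is, the restriction of $a$ to $\ker\iota$ factors through a homomorphism of group schemes $\alpha:\ker\iota\to\ker\iota_1$. 2. Put $\Gamma=(\ker\iota)_K$ and $\Gamma_1=(\ker\iota_1)_K$. There is a well-defined map $a_*:H^1(K,\Gamma)\to H^1(K,\Gamma_1)$ such that $a_*(P)$ is the class of the quotient $Q$ of $P\times_K\Gamma_1$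 by the action $\gamma\cdot(x,z)=(\gamma^{-1}x,\alpha(\gamma)z)$ of $\Gamma$, with the action of $\Gamma_1$ induced by translation on the second factor. Moreover, for all $P\in H^1(K,\Gamma)$ and all $w\in F_K^*\omega_{\Gamma_1}$, $$\Phi_{\Gamma_1}(a_*(P))(w)=\Phi_\Gamma(P)(a^*(w)),$$ where $a^*:F_K^*\omega_{\Gamma_1}\to F_K^*\omega_\Gamma$ is the pull-back of differential forms along $\alpha_K$. -/

import Mathlib

open CategoryTheory Limits Opposite TopologicalSpace MonoidalCategory CartesianMonoidalCategory AlgebraicGeometry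
open scoped TensorProduct MonObj

universe u

noncomputable section

namespace HeightOne

/-- A scheme is of characteristic `p` if `p = 0` in its ring of functions. -/
class CharPScheme (X : Scheme.{u}) (p : ℕ) : Prop where
  cast_eq_zero : (p : Γ(X, ⊤)) = 0

lemma CharPScheme.of_hom {X Y : Scheme.{u}} (f : X ⟶ Y) (p : ℕ) [CharPScheme Y p] :
    CharPScheme X p :=
  ⟨by simpa using congrArg f.appTop.hom (CharPScheme.cast_eq_zero (X := Y) (p := p))⟩

lemma CharPScheme.cast_section {X : Scheme.{u}} (p : ℕ) [CharPScheme X p] (U : X.Opens) :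
    (p : Γ(X, U)) = 0 := by
  simpa using congrArg (X.presheaf.map (homOfLE le_top : U ⟶ ⊤).op).hom
    (CharPScheme.cast_eq_zero (X := X) (p := p))

/-- The ring endomorphism `r ↦ r ^ p` of a commutative ring in which the prime `p` is zero. -/
def frobHom (R : Type u) [CommRing R] (p : ℕ) [hp : Fact p.Prime] (h : (p : R) = 0) : R →+* R where
  toFun r := r ^ p
  map_one' := one_pow p
  map_mul' x y := mul_pow x y p
  map_zero' := zero_pow hp.out.ne_zero
  map_add' x y := by
    rw [add_pow_prime_eq hp.out, h]
    ring

variable (p : ℕ) [hp : Fact p.Prime]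

/-- The absolute Frobenius of a scheme of characteristic `p`: the identity on the underlying space
and `s ↦ s ^ p` on sections. -/
def absFrob (X : Scheme.{u}) [CharPScheme X p] : X ⟶ X where
  base := 𝟙 _
  c :=
    { app U := CommRingCat.ofHom (frobHom Γ(X, U.unop) p (CharPScheme.cast_section p U.unop))
      naturality U V f := by
        ext s
        exact ((X.presheaf.map f).hom.map_pow s p).symm }
  prop x := by
    refine ⟨fun t ht ↦ ?_⟩
    obtain ⟨U, hxU, s, rfl⟩ := X.presheaf.exists_germ_eq t
    erw [PresheafedSpace.stalkMap_germ_apply] at ht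
    have h1 : IsUnit (X.presheaf.germ U x hxU (s ^ p)) := ht
    rw [map_pow] at h1
    exact (isUnit_pow_iff hp.out.ne_zero).1 h1

lemma absFrob_app (X : Scheme.{u}) [CharPScheme X p] (U : X.Opens) (s : Γ(X, U)) :
    ((absFrob p X).app U).hom s = s ^ p := rfl

lemma absFrob_base (X : Scheme.{u}) [CharPScheme X p] : (absFrob p X).base = 𝟙 _ := rfl

lemma absFrob_naturality {X Y : Scheme.{u}} [CharPScheme X p] [CharPScheme Y p] (f : X ⟶ Y) :
    absFrob p X ≫ f = f ≫ absFrob p Y := by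
  refine Scheme.Hom.ext rfl fun U ↦ ?_
  ext s
  have h : (X.presheaf.map (eqToHom (show op (f ⁻¹ᵁ U) = op (f ⁻¹ᵁ U) from rfl))).hom
      ((f.app U).hom s ^ p) = (f.app U).hom (s ^ p) := by
    rw [eqToHom_refl, X.presheaf.map_id]
    exact (map_pow (f.app U).hom s p).symm
  exact h

lemma absFrob_naturality_assoc {X Y Z : Scheme.{u}} [CharPScheme X p] [CharPScheme Y p]
    (f : X ⟶ Y) (g : Y ⟶ Z) : absFrob p X ≫ f ≫ g = f ≫ absFrob p Y ≫ g := by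
  rw [← Category.assoc, absFrob_naturality, Category.assoc]

lemma absFrob_Spec (R : CommRingCat.{u}) [CharPScheme (Spec R) p] (h : (p : R) = 0) :
    absFrob p (Spec R) = Spec.map (CommRingCat.ofHom (frobHom R p h)) := by
  apply ext_of_isAffine
  rw [← cancel_epi (Scheme.ΓSpecIso R).inv]
  ext s
  have h1 := congrArg (fun g ↦ g.hom s)
    (Scheme.ΓSpecIso_inv_naturality (CommRingCat.ofHom (frobHom R p h)))
  have h1 : (Scheme.ΓSpecIso R).inv.hom (s ^ p) = _ := h1
  rw [map_pow] at h1
  exact h1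

/-- The absolute Frobenius is the identity on points. -/
lemma absFrob_apply (X : Scheme.{u}) [CharPScheme X p] (x : X) : absFrob p X x = x := rfl


section Groups

variable {S : Scheme.{u}}

instance [CharPScheme S p] (G : Over S) : CharPScheme G.left p := .of_hom G.hom p

instance {T : Scheme.{u}} (f : T ⟶ S) (G : Over S) [GrpObj G] :
    GrpObj ((Over.pullback f).obj G) :=
  Functor.grpObjObj

instance {T : Scheme.{u}} (f : T ⟶ S) (G : Over S) [GrpObj G] [IsCommMonObj G] :
    IsCommMonObj ((Over.pullback f).obj G) :=
  Functor.isCommMonObj_obj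

instance {T : Scheme.{u}} (f : T ⟶ S) {G H : Over S} [GrpObj G] [GrpObj H] (g : G ⟶ H)
    [IsMonHom g] : IsMonHom ((Over.pullback f).map g) :=
  Functor.map.instIsMonHom _ _ g

lemma one_pullback_fst {T : Scheme.{u}} (f : T ⟶ S) (G : Over S) [GrpObj G] :
    (η[(Over.pullback f).obj G]).left ≫ pullback.fst G.hom f = f ≫ η[G].left := by
  have h : η[(Over.pullback f).obj G] =
    Functor.LaxMonoidal.ε (Over.pullback f) ≫ (Over.pullback f).map η[G] := rfl
  rw [h, Over.comp_left, Category.assoc, Over.ε_pullback_left]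
  have h2 : ((Over.pullback f).map η[G]).left ≫ pullback.fst G.hom f =
    pullback.fst (𝟙 S) f ≫ η[G].left := pullback.lift_fst _ _ _
  rw [h2, IsIso.inv_comp_eq, ← Category.assoc, ← pullback.condition]
  simp

/-- The base change `G ^ (p)` of `G` along the absolute Frobenius of the base. -/
abbrev frobTwist [CharPScheme S p] (G : Over S) : Over S :=
  (Over.pullback (absFrob p S)).obj G

/-- The relative Frobenius `G ⟶ G ^ (p)`. -/
def relFrob [CharPScheme S p] (G : Over S) : G ⟶ frobTwist p G :=
  Over.homMk (pullback.lift (absFrob p G.left) G.hom (absFrob_naturality p G.hom))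
    (pullback.lift_snd _ _ _)

/-- A group scheme `G` over a base of characteristic `p` is of height one if it is finite and flat
over the base and if its relative Frobenius is the zero homomorphism. -/
class IsHeightOne [CharPScheme S p] (G : Over S) [GrpObj G] : Prop where
  finite : IsFinite G.hom
  flat : Flat G.hom
  relFrob_eq_one : relFrob p G = 1

lemma relFrob_eq_one_iff [CharPScheme S p] (G : Over S) [GrpObj G] :
    relFrob p G = 1 ↔ absFrob p G.left = G.hom ≫ absFrob p S ≫ η[G].left := by
  have key : (1 : G ⟶ frobTwist p G).left ≫ pullback.fst G.hom (absFrob p S) =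
      G.hom ≫ absFrob p S ≫ η[G].left := by
    rw [Hom.one_def, Over.comp_left, Category.assoc, one_pullback_fst]
    rfl
  constructor
  · intro h
    rw [← key, ← h]
    exact (pullback.lift_fst _ _ _).symm
  · intro h
    ext : 1
    apply pullback.hom_ext
    · rw [key, ← h]
      exact pullback.lift_fst _ _ _
    · exact (Over.w _).trans (Over.w _).symm

/-- The height one property is stable under base change. -/
instance IsHeightOne.baseChange {T : Scheme.{u}} (f : T ⟶ S) [CharPScheme S p] [CharPScheme T p]
    (G : Over S) [GrpObj G] [h : IsHeightOne p G] : IsHeightOne p ((Over.pullback f).obj G) where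
  finite := by
    have := h.finite
    exact inferInstanceAs (IsFinite (pullback.snd G.hom f))
  flat := by
    have := h.flat
    exact inferInstanceAs (Flat (pullback.snd G.hom f))
  relFrob_eq_one := by
    have h1 := (relFrob_eq_one_iff p G).1 h.relFrob_eq_one
    rw [relFrob_eq_one_iff]
    have : CharPScheme (pullback G.hom f) p := .of_hom (pullback.snd G.hom f) p
    apply pullback.hom_ext
    · have h2 := absFrob_naturality p (pullback.fst G.hom f)
      refine h2.trans ?_
      rw [h1, Category.assoc, Category.assoc, one_pullback_fst, pullback.condition_assoc,
        absFrob_naturality_assoc]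
      rfl
    · have h2 := absFrob_naturality p (pullback.snd G.hom f)
      refine h2.trans ?_
      have h3 : η[(Over.pullback f).obj G].left ≫ pullback.snd G.hom f = 𝟙 _ :=
        Over.w η[(Over.pullback f).obj G]
      rw [Category.assoc, Category.assoc, h3]
      rfl

section Ker

variable {G H : Over S} [GrpObj H] (f : G ⟶ H)

/-- The kernel of a homomorphism of group schemes, as a scheme: the fibre product of `f` with the
unit section. -/
def ker : Over S := pullback f η[H]

/-- The inclusion of the kernel. -/
def kerι : ker f ⟶ G := pullback.fst f η[H]

lemma isPullback_ker : IsPullback (kerι f) (toUnit _) f η[H] := by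
  have h : pullback.snd f η[H] = toUnit (ker f) := toUnit_unique _ _
  rw [← h]
  exact IsPullback.of_hasPullback f η[H]

instance : Mono (kerι f) := inferInstanceAs (Mono (pullback.fst f η[H]))

/-- The morphism to the kernel given by a morphism whose composition with `f` is trivial. -/
def kerLift {X : Over S} (x : X ⟶ G) (hx : x ≫ f = 1) : X ⟶ ker f :=
  (isPullback_ker f).lift x (toUnit X) hx

@[simp]
lemma kerLift_ι {X : Over S} (x : X ⟶ G) (hx : x ≫ f = 1) : kerLift f x hx ≫ kerι f = x :=
  (isPullback_ker f).lift_fst _ _ _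

@[simp]
lemma kerι_comp : kerι f ≫ f = 1 := (isPullback_ker f).w

@[simp]
lemma kerLift_ι_assoc {X Y : Over S} (x : X ⟶ G) (hx : x ≫ f = 1) (g : G ⟶ Y) :
    kerLift f x hx ≫ kerι f ≫ g = x ≫ g := by
  rw [← Category.assoc, kerLift_ι]

@[simp]
lemma kerι_comp_assoc {Y : Over S} (g : H ⟶ Y) :
    kerι f ≫ f ≫ g = (1 : ker f ⟶ H) ≫ g := by
  rw [← Category.assoc, kerι_comp]

variable [GrpObj G] [IsMonHom f]

/-- The group scheme structure on the kernel, induced by that of the source. -/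
instance : GrpObj (ker f) where
  one := kerLift f η[G] (by simp [Hom.one_def])
  mul := kerLift f ((fst _ _ ≫ kerι f) * (snd _ _ ≫ kerι f)) (by simp [MonObj.mul_comp])
  inv := kerLift f (kerι f)⁻¹ (by simp [GrpObj.inv_comp])
  one_mul := by
    have h : fst (𝟙_ (Over S)) (ker f) ≫ η[G] = 1 :=
      congrArg (· ≫ η[G]) (toUnit_unique _ _)
    rw [← cancel_mono (kerι f)]
    simp [MonObj.comp_mul, h, leftUnitor_hom]
  mul_one := by
    have h : snd (ker f) (𝟙_ (Over S)) ≫ η[G] = 1 :=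
      congrArg (· ≫ η[G]) (toUnit_unique _ _)
    rw [← cancel_mono (kerι f)]
    simp [MonObj.comp_mul, h, rightUnitor_hom]
  mul_assoc := by
    rw [← cancel_mono (kerι f)]
    simp [MonObj.comp_mul, mul_assoc]
  left_inv := by
    rw [← cancel_mono (kerι f)]
    simp [MonObj.comp_mul, Hom.one_def]
  right_inv := by
    rw [← cancel_mono (kerι f)]
    simp [MonObj.comp_mul, Hom.one_def]

instance : IsMonHom (kerι f) where
  one_hom := kerLift_ι _ _ _
  mul_hom := by
    refine (kerLift_ι _ _ _).trans ?_
    simp [Hom.mul_def]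

instance [IsCommMonObj G] : IsCommMonObj (ker f) where
  mul_comm := by
    have h : μ[ker f] ≫ kerι f = (fst _ _ ≫ kerι f) * (snd _ _ ≫ kerι f) := kerLift_ι _ _ _
    rw [← cancel_mono (kerι f), Category.assoc, h, MonObj.comp_mul, mul_comm]
    simp

end Ker

end Groups

section Torsors

variable {S : Scheme.{u}}

/-- A torsor under a group scheme `G` over `S`: an `S`-scheme with an action of `G`, faithfully flat
and locally of finite presentation over `S`, such that `(g, x) ↦ (g • x, x)` is an isomorphism. -/
structure Torsor (G : Over S) [GrpObj G] where
  /-- The underlying scheme. -/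
  X : Over S
  /-- The action. -/
  [act : ModObj G X]
  flat : Flat X.hom
  surjective : Surjective X.hom
  locallyOfFinitePresentation : LocallyOfFinitePresentation X.hom
  isIso_leftSMul : IsIso (ModObj.leftSMul G X)

attribute [instance] Torsor.act

variable {G : Over S} [GrpObj G]

/-- Torsors are isomorphic if there is an equivariant isomorphism between them. -/
instance Torsor.setoid (G : Over S) [GrpObj G] : Setoid (Torsor G) where
  r P Q := ∃ e : P.X ≅ Q.X, IsModHom G e.hom
  iseqv :=
    { refl P := ⟨Iso.refl _, inferInstanceAs (IsModHom G (𝟙 P.X))⟩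
      symm := fun ⟨e, _⟩ ↦ ⟨e.symm, inferInstanceAs (IsModHom G e.inv)⟩
      trans := fun ⟨e, _⟩ ⟨e', _⟩ ↦
        ⟨e ≪≫ e', inferInstanceAs (IsModHom G (e.hom ≫ e'.hom))⟩ }

/-- The set `H¹(S, G)` of isomorphism classes of torsors under `G`. -/
def H1 (G : Over S) [GrpObj G] : Type (u + 1) := Quotient (Torsor.setoid G)

/-- The class of a torsor. -/
def Torsor.cls (P : Torsor G) : H1 G := Quotient.mk _ P

/-- The difference of two points `x`, `y` of a torsor: the point `g` of `G` with `g • y = x`. -/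
def Torsor.diff (P : Torsor G) {T : Over S} (x y : T ⟶ P.X) : T ⟶ G :=
  have := P.isIso_leftSMul
  lift x y ≫ inv (ModObj.leftSMul G P.X) ≫ fst _ _

lemma Torsor.existsUnique (P : Torsor G) {T : Over S} (x y : T ⟶ P.X) :
    ∃! g : T ⟶ G, g • y = x :=
  ModObj.isIso_leftSMul_iff.1 P.isIso_leftSMul T y x

lemma Torsor.diff_smul (P : Torsor G) {T : Over S} (x y : T ⟶ P.X) : P.diff x y • y = x := by
  have := P.isIso_leftSMul
  have h0 : inv (ModObj.leftSMul G P.X) ≫ snd _ _ = snd _ _ := by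
    rw [IsIso.inv_comp_eq, ModObj.leftSMul_snd]
  have h : lift (P.diff x y) y = lift x y ≫ inv (ModObj.leftSMul G P.X) := by
    apply CartesianMonoidalCategory.hom_ext
    · simp [Torsor.diff]
    · simp [h0]
  rw [← ModObj.lift_leftSMul_eq_lift_iff, h]
  simp

lemma Torsor.diff_eq_iff (P : Torsor G) {T : Over S} (x y : T ⟶ P.X) (g : T ⟶ G) :
    P.diff x y = g ↔ g • y = x :=
  ⟨fun h ↦ h ▸ P.diff_smul x y, fun h ↦ (P.existsUnique x y).unique (P.diff_smul x y) h⟩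

section Frobenius

variable [CharPScheme S p]

lemma Torsor.exists_frobSection (P : Torsor G) [h : IsHeightOne p G] :
    ∃ σ : S ⟶ P.X.left, P.X.hom ≫ σ = absFrob p P.X.left := by
  have := P.flat
  have := P.surjective
  have := P.locallyOfFinitePresentation
  have := P.isIso_leftSMul
  have hG := (relFrob_eq_one_iff p G).1 h.relFrob_eq_one
  let W : Over S := Over.mk ((G ⊗ P.X).hom ≫ absFrob p S)
  let φ : W ⟶ G ⊗ P.X := Over.homMk (absFrob p (G ⊗ P.X).left) (absFrob_naturality p _)
  have h1 : φ ≫ fst _ _ = 1 := by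
    ext : 1
    refine (absFrob_naturality p (fst G P.X).left).trans ?_
    rw [hG, Over.w_assoc]
    simp [W, Hom.one_def]
  have h2 : φ ≫ γ[G, P.X] = φ ≫ snd _ _ := by
    have : φ ≫ γ[G, P.X] = (φ ≫ fst _ _) • (φ ≫ snd _ _) := by
      rw [Hom.smul_def, ← comp_lift, lift_fst_snd, Category.comp_id]
    rw [this, h1, one_smul]
  have h3 : γ[G, P.X].left ≫ absFrob p P.X.left =
      (snd G P.X).left ≫ absFrob p P.X.left := by
    rw [← absFrob_naturality, ← absFrob_naturality]
    exact congrArg (fun t ↦ t.left) h2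
  have h4 : (fst P.X P.X).left ≫ absFrob p P.X.left = (snd P.X P.X).left ≫ absFrob p P.X.left := by
    have : IsIso (ModObj.leftSMul G P.X).left :=
      inferInstanceAs (IsIso ((Over.forget S).map (ModObj.leftSMul G P.X)))
    rw [← cancel_epi (ModObj.leftSMul G P.X).left, ← Category.assoc, ← Category.assoc,
      ← Over.comp_left, ← Over.comp_left, ModObj.leftSMul_fst, ModObj.leftSMul_snd]
    exact h3
  have h5 : ∀ {Z : Scheme.{u}} (g₁ g₂ : Z ⟶ P.X.left), g₁ ≫ P.X.hom = g₂ ≫ P.X.hom →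
      g₁ ≫ absFrob p P.X.left = g₂ ≫ absFrob p P.X.left := by
    intro Z g₁ g₂ hg
    have := congrArg (fun t ↦ pullback.lift g₁ g₂ hg ≫ t) h4
    exact (pullback.lift_fst_assoc _ _ _ _).symm.trans
      (this.trans (pullback.lift_snd_assoc _ _ _ _))
  exact ⟨EffectiveEpi.desc P.X.hom _ h5, EffectiveEpi.fac P.X.hom _ h5⟩

end Frobenius
end Torsors

section Field

variable (K : Type u) [Field K] [CharP K p]

instance : CharPScheme (Spec (.of K)) p where
  cast_eq_zero := by
    have h := congrArg (Scheme.ΓSpecIso (.of K)).inv.hom (CharP.cast_eq_zero K p)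
    exact ((map_natCast _ p).symm.trans h).trans (map_zero _)

/-- The field `K`, viewed as an extension of itself by means of the Frobenius endomorphism. -/
def FrobExt (_p : ℕ) (K : Type u) : Type u := K

instance : Field (FrobExt p K) := inferInstanceAs (Field K)

/-- The structure of `R`-algebra on `FrobExt p K` for an `R`-algebra `K`: the composition of
`R → K` with the Frobenius of `K` (if `R` has characteristic `p`, this is also the composition
of the Frobenius of `R` with `R → K`). In particular `K → FrobExt p K` is the Frobenius of `K`. -/
instance {R : Type u} [CommRing R] [Algebra R K] : Algebra R (FrobExt p K) :=
  ((frobHom K p (CharP.cast_eq_zero K p)).comp (algebraMap R K)).toAlgebra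

instance {R : Type u} [CommRing R] [Algebra R K] : IsScalarTower R K (FrobExt p K) :=
  .of_algebraMap_eq fun _ ↦ rfl

lemma algebraMap_frobExt (x : K) :
    algebraMap K (FrobExt p K) x = (show FrobExt p K from x ^ p) := rfl

/-- `Spec L` as a scheme over `Spec K`, for a `K`-algebra `L`. -/
def specOver {K : Type u} [Field K] (L : Type u) [CommRing L] [Algebra K L] :
    Over (Spec (.of K)) :=
  Over.mk (Spec.map (CommRingCat.ofHom (algebraMap K L)))

/-- The morphism `Spec L' ⟶ Spec L` given by a homomorphism `L → L'` of `K`-algebras. -/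
def specOverMap {K : Type u} [Field K] {L L' : Type u} [CommRing L] [Algebra K L] [CommRing L']
    [Algebra K L'] (f : L →ₐ[K] L') : specOver (K := K) L' ⟶ specOver L :=
  Over.homMk (Spec.map (CommRingCat.ofHom f.toRingHom)) (by
    refine (Spec.map_comp _ _).symm.trans (congrArg Spec.map ?_)
    ext x
    exact f.commutes x)

lemma specOver_frobExt_hom : (specOver (K := K) (FrobExt p K)).hom = absFrob p (Spec (.of K)) :=
  (absFrob_Spec p (.of K) (CharP.cast_eq_zero K p)).symm

instance : Epi (absFrob p (Spec (.of K))) := by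
  have h1 : Flat (absFrob p (Spec (.of K))) := by
    rw [← specOver_frobExt_hom]
    change Flat (Spec.map (CommRingCat.ofHom (algebraMap K (FrobExt p K))))
    rw [HasRingHomProperty.Spec_iff (P := @Flat)]
    exact (inferInstance : Module.Flat K (FrobExt p K))
  have h2 : Surjective (absFrob p (Spec (.of K))) := ⟨fun x ↦ ⟨x, rfl⟩⟩
  have h3 : QuasiCompact (absFrob p (Spec (.of K))) := inferInstance
  infer_instance

variable {K} {G : Over (Spec (.of K))} [GrpObj G]

/-- A torsor `λ : P ⟶ Spec K` under a group scheme of height one has a unique `σ : Spec K ⟶ P` such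
that `λ ∘ σ` is the Frobenius of `Spec K`. -/
lemma Torsor.existsUnique_frobPoint (P : Torsor G) [h : IsHeightOne p G] :
    ∃! _σ : specOver (K := K) (FrobExt p K) ⟶ P.X, True := by
  have := P.flat
  have := P.surjective
  have := P.locallyOfFinitePresentation
  obtain ⟨σ, hσ⟩ := P.exists_frobSection p
  have h1 : σ ≫ P.X.hom = absFrob p (Spec (.of K)) := by
    rw [← cancel_epi P.X.hom, reassoc_of% hσ, absFrob_naturality]
  refine ⟨Over.homMk σ (h1.trans (specOver_frobExt_hom p K).symm), trivial, fun τ _ ↦ ?_⟩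
  ext : 1
  let t : Spec (.of K) ⟶ P.X.left := τ.left
  have h3 : t ≫ P.X.hom = absFrob p (Spec (.of K)) :=
    (Over.w τ).trans (specOver_frobExt_hom p K)
  have h2 : absFrob p (Spec (.of K)) ≫ t = absFrob p (Spec (.of K)) ≫ σ := by
    rw [absFrob_naturality, ← hσ, reassoc_of% h3]
  have h4 : t = σ := (cancel_epi (absFrob p (Spec (.of K)))).1 h2
  exact h4

/-- The unique point `σ : Spec K ⟶ P` of a torsor lying over the Frobenius of `Spec K`. -/
def Torsor.frobPoint (P : Torsor G) [IsHeightOne p G] : specOver (K := K) (FrobExt p K) ⟶ P.X :=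
  (P.existsUnique_frobPoint p).choose

lemma Torsor.eq_frobPoint (P : Torsor G) [IsHeightOne p G]
    (τ : specOver (K := K) (FrobExt p K) ⟶ P.X) : τ = P.frobPoint p :=
  (P.existsUnique_frobPoint p).unique trivial trivial

/-- Torsors under group schemes of height one are affine. -/
lemma Torsor.isAffine (P : Torsor G) [IsHeightOne p G] : IsAffine P.X.left := by
  obtain ⟨σ, hσ⟩ := P.exists_frobSection p
  have : Subsingleton P.X.left := by
    refine ⟨fun x y ↦ ?_⟩
    have h (z : P.X.left) : σ (P.X.hom z) = z := by
      rw [← Scheme.Hom.comp_apply, hσ, absFrob_apply]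
    have : Subsingleton (Spec (.of K)) := inferInstanceAs (Subsingleton (PrimeSpectrum K))
    rw [← h x, ← h y, Subsingleton.elim (P.X.hom x)]
  infer_instance

end Field

section Cotangent

variable {K : Type u} [CommRing K] {A B L : Type u} [CommRing A] [Algebra K A] [CommRing B]
  [Algebra K B] [CommRing L] [Algebra K L]

/-- The ring `L`, viewed as an `A`-algebra by means of the `L`-valued point `s : A → L`. -/
def PtRing (_s : A →ₐ[K] L) : Type u := L

instance (s : A →ₐ[K] L) : CommRing (PtRing s) := inferInstanceAs (CommRing L)

instance (s : A →ₐ[K] L) : Algebra A (PtRing s) := RingHom.toAlgebra (S := L) s.toRingHom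

/-- The pull-back `L ⊗_A Ω_{A/K}` of the module of differentials of the `K`-algebra `A` along the
`L`-valued point `s : A → L`. -/
def Cot (s : A →ₐ[K] L) : Type u := PtRing s ⊗[A] Ω[A⁄K]

namespace Cot

instance (s : A →ₐ[K] L) : AddCommGroup (Cot s) :=
  inferInstanceAs (AddCommGroup (PtRing s ⊗[A] Ω[A⁄K]))

instance (s : A →ₐ[K] L) : Module L (Cot s) :=
  inferInstanceAs (Module (PtRing s) (PtRing s ⊗[A] Ω[A⁄K]))

/-- The element `1 ⊗ da` of `L ⊗_A Ω_{A/K}`. -/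
def d (s : A →ₐ[K] L) (a : A) : Cot s :=
  (1 : PtRing s) ⊗ₜ[A] KaehlerDifferential.D K A a

variable (s : A →ₐ[K] L)

lemma d_add (a b : A) : d s (a + b) = d s a + d s b := by
  change (1 : PtRing s) ⊗ₜ[A] KaehlerDifferential.D K A (a + b) = _
  rw [map_add, TensorProduct.tmul_add]
  rfl

lemma d_algebraMap (k : K) : d s (algebraMap K A k) = 0 := by
  change (1 : PtRing s) ⊗ₜ[A] KaehlerDifferential.D K A (algebraMap K A k) = _
  rw [Derivation.map_algebraMap, TensorProduct.tmul_zero]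
  rfl

lemma smul_d (a b : A) : (1 : PtRing s) ⊗ₜ[A] (a • KaehlerDifferential.D K A b) = s a • d s b := by
  rw [← TensorProduct.smul_tmul]
  have h : a • (1 : PtRing s) = (show PtRing s from s a) * 1 := rfl
  rw [h]
  exact (TensorProduct.smul_tmul' (show PtRing s from s a) (1 : PtRing s)
    (KaehlerDifferential.D K A b)).symm

lemma d_mul (a b : A) : d s (a * b) = s a • d s b + s b • d s a := by
  rw [← smul_d, ← smul_d, d, Derivation.leibniz, TensorProduct.tmul_add]
  rfl

variable {s}

/-- A module over `L`, viewed as a module over `A` and over `K` by means of `s : A → L`. -/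
def PtMod (_s : A →ₐ[K] L) (M : Type*) := M

section PtMod

variable {M : Type*} [AddCommGroup M] [Module L M]

instance : AddCommGroup (PtMod s M) := inferInstanceAs (AddCommGroup M)

instance : Module (PtRing s) (PtMod s M) := inferInstanceAs (Module L M)

instance : Module A (PtMod s M) := Module.compHom (R := L) M s.toRingHom

instance : Module K (PtMod s M) := Module.compHom (R := L) M (algebraMap K L)

instance : IsScalarTower A (PtRing s) (PtMod s M) := .of_algebraMap_smul fun _ _ ↦ rfl

instance : IsScalarTower K A (PtMod s M) := .of_algebraMap_smul fun k m ↦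
  congrArg (fun l : L ↦ l • (show M from m)) (s.commutes k)

end PtMod

/-- The map `δ`, as a derivation. -/
def toDerivation {M : Type*} [AddCommGroup M] [Module L M] (δ : A → M)
    (hadd : ∀ a b, δ (a + b) = δ a + δ b) (hK : ∀ k : K, δ (algebraMap K A k) = 0)
    (hmul : ∀ a b, δ (a * b) = s a • δ b + s b • δ a) : Derivation K A (PtMod s M) :=
  Derivation.mk'
    { toFun := δ
      map_add' := hadd
      map_smul' := fun k a ↦ by
        rw [Algebra.smul_def, hmul, hK, smul_zero, add_zero, s.commutes]
        rfl } hmul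

/-- The linear map on `L ⊗_A Ω_{A/K}` given by a `K`-derivation `δ` along `s`. -/
def lift {M : Type*} [AddCommGroup M] [Module L M] (δ : A → M)
    (hadd : ∀ a b, δ (a + b) = δ a + δ b) (hK : ∀ k : K, δ (algebraMap K A k) = 0)
    (hmul : ∀ a b, δ (a * b) = s a • δ b + s b • δ a) : Cot s →ₗ[L] M :=
  let f : (PtRing s ⊗[A] Ω[A⁄K]) →ₗ[PtRing s] PtMod s M :=
    LinearMap.liftBaseChange (PtRing s)
      (toDerivation (s := s) δ hadd hK hmul).liftKaehlerDifferential
  { toFun := fun x ↦ f x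
    map_add' := f.map_add
    map_smul' := f.map_smul }

@[simp]
lemma lift_d {M : Type*} [AddCommGroup M] [Module L M] (δ : A → M)
    (hadd : ∀ a b, δ (a + b) = δ a + δ b) (hK : ∀ k : K, δ (algebraMap K A k) = 0)
    (hmul : ∀ a b, δ (a * b) = s a • δ b + s b • δ a) (a : A) :
    lift δ hadd hK hmul (d s a) = δ a := by
  let D := toDerivation (s := s) δ hadd hK hmul
  have h : D.liftKaehlerDifferential.liftBaseChange (PtRing s)
      ((1 : PtRing s) ⊗ₜ[A] KaehlerDifferential.D K A a) = D a := by
    rw [LinearMap.liftBaseChange_tmul, one_smul, Derivation.liftKaehlerDifferential_comp_D]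
  exact h

lemma ext {M : Type*} [AddCommGroup M] [Module L M] {f g : Cot s →ₗ[L] M}
    (h : ∀ a, f (d s a) = g (d s a)) : f = g := by
  let f' : (PtRing s ⊗[A] Ω[A⁄K]) →ₗ[PtRing s] PtMod s M := f
  let g' : (PtRing s ⊗[A] Ω[A⁄K]) →ₗ[PtRing s] PtMod s M := g
  suffices f' = g' from this
  apply (LinearMap.liftBaseChangeEquiv (PtRing s) (R := A) (M := Ω[A⁄K])
    (N := PtMod s M)).symm.injective
  apply Derivation.liftKaehlerDifferential_unique
  ext a
  exact h a

/-- The pull-back of differentials along `g : B → A`. -/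
def comap {s : A →ₐ[K] L} {t : B →ₐ[K] L} (g : B →ₐ[K] A) (h : s.comp g = t) :
    Cot t →ₗ[L] Cot s :=
  lift (fun b ↦ d s (g b)) (fun a b ↦ by rw [map_add, d_add])
    (fun k ↦ by rw [g.commutes, d_algebraMap]) (fun a b ↦ by rw [map_mul, d_mul, ← h]; rfl)

@[simp]
lemma comap_d {s : A →ₐ[K] L} {t : B →ₐ[K] L} (g : B →ₐ[K] A) (h : s.comp g = t) (b : B) :
    comap g h (d t b) = d s (g b) := lift_d _ _ _ _ _

/-- The map `L ⊗_A Ω_{A/K} → Ω_{L/K}` induced by `s : A → L`. -/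
def toKaehler (s : A →ₐ[K] L) : Cot s →ₗ[L] Ω[L⁄K] :=
  lift (fun a ↦ KaehlerDifferential.D K L (s a)) (fun a b ↦ by rw [map_add, map_add])
    (fun k ↦ by rw [s.commutes, Derivation.map_algebraMap])
    (fun a b ↦ by rw [map_mul, Derivation.leibniz])

@[simp]
lemma toKaehler_d (s : A →ₐ[K] L) (a : A) :
    toKaehler s (d s a) = KaehlerDifferential.D K L (s a) := lift_d _ _ _ _ _

lemma toKaehler_comap {s : A →ₐ[K] L} {t : B →ₐ[K] L} (g : B →ₐ[K] A) (h : s.comp g = t)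
    (x : Cot t) : toKaehler s (comap g h x) = toKaehler t x := by
  have : (toKaehler s).comp (comap g h) = toKaehler t := by
    apply Cot.ext
    intro b
    subst h
    simp
  exact congrArg (fun f ↦ f x) this

end Cot

/-- The ring `L ⊕ N` with `N` of square zero. -/
def SqZero (L N : Type u) : Type u := TrivSqZeroExt L N

namespace SqZero

variable {N : Type u} [AddCommGroup N] [Module L N]

instance : CommRing (SqZero L N) :=
  letI : Module Lᵐᵒᵖ N := Module.compHom N ((RingHom.id L).fromOpposite mul_comm)
  haveI : IsCentralScalar L N := ⟨fun _ _ ↦ rfl⟩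
  inferInstanceAs (CommRing (TrivSqZeroExt L N))

/-- The inclusion of `L` into `L ⊕ N`, as a ring homomorphism. -/
def inlHom (L N : Type u) [CommRing L] [AddCommGroup N] [Module L N] : L →+* SqZero L N :=
  letI : Module Lᵐᵒᵖ N := Module.compHom N ((RingHom.id L).fromOpposite mul_comm)
  haveI : IsCentralScalar L N := ⟨fun _ _ ↦ rfl⟩
  TrivSqZeroExt.inlHom L N

instance : Algebra K (SqZero L N) := ((inlHom L N).comp (algebraMap K L)).toAlgebra

/-- The component in `N`. -/
def snd (x : SqZero L N) : N := TrivSqZeroExt.snd x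

/-- The projection to `L`. -/
def fst : SqZero L N →ₐ[K] L where
  toFun x := TrivSqZeroExt.fst x
  map_one' := rfl
  map_mul' _ _ := rfl
  map_zero' := rfl
  map_add' _ _ := rfl
  commutes' _ := rfl

/-- The inclusion of `L`. -/
def inl : L →ₐ[K] SqZero L N where
  __ := inlHom L N
  commutes' _ := rfl

lemma snd_add (x y : SqZero L N) : snd (x + y) = snd x + snd y := rfl

lemma snd_mul (x y : SqZero L N) :
    snd (x * y) = fst (K := K) x • snd y + fst (K := K) y • snd x := rfl

lemma snd_algebraMap (k : K) : snd (algebraMap K (SqZero L N) k) = 0 := rfl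

lemma ext' {x y : SqZero L N} (h₁ : fst (K := K) x = fst (K := K) y) (h₂ : snd x = snd y) :
    x = y := TrivSqZeroExt.ext h₁ h₂

/-- The homomorphism `a ↦ (s a, 1 ⊗ da)`: the universal first order deformation of `s`. -/
def univ (s : A →ₐ[K] L) : A →ₐ[K] SqZero L (Cot s) where
  toFun a := (s a, Cot.d s a)
  map_one' := ext' (K := K) (map_one s) (by
    have := Cot.d_algebraMap s 1
    rwa [map_one] at this)
  map_mul' a b := ext' (K := K) (map_mul s a b) (Cot.d_mul s a b)
  map_zero' := ext' (K := K) (map_zero s) (by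
    have := Cot.d_algebraMap s 0
    rwa [map_zero] at this)
  map_add' a b := ext' (K := K) (map_add s a b) (Cot.d_add s a b)
  commutes' k := ext' (K := K) (s.commutes k) (Cot.d_algebraMap s k)

/-- The homomorphism `L ⊕ N → L ⊕ N'` given by a linear map `N → N'`. -/
def map {N' : Type u} [AddCommGroup N'] [Module L N'] (f : N →ₗ[L] N') :
    SqZero L N →ₐ[K] SqZero L N' where
  toFun x := (fst (K := K) x, f (snd x))
  map_one' := ext' (K := K) rfl f.map_zero
  map_mul' x y := ext' (K := K) rfl (by
    refine (congrArg f (snd_mul (K := K) x y)).trans ?_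
    rw [map_add, map_smul, map_smul]
    rfl)
  map_zero' := ext' (K := K) rfl f.map_zero
  map_add' x y := ext' (K := K) rfl (f.map_add _ _)
  commutes' k := ext' (K := K) rfl f.map_zero

end SqZero
end Cotangent

section Kaehler

variable (K : Type u) [Field K] [CharP K p]

/-- The canonical isomorphism between `Ω_{K^[1]/k₀}` and `Ω_{F_K}`. -/
def kaehlerFrobEquiv (k₀ : Type u) [CommRing k₀] [Algebra k₀ K] :
    Ω[FrobExt p K⁄k₀] ≃ₗ[FrobExt p K] Ω[FrobExt p K⁄K] :=
  LinearEquiv.ofBijective (KaehlerDifferential.map k₀ K (FrobExt p K) (FrobExt p K)) (by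
    refine ⟨?_, KaehlerDifferential.map_surjective _ _ _⟩
    have h0 : (KaehlerDifferential.mapBaseChange k₀ K (FrobExt p K)) = 0 := by
      have : CharP (FrobExt p K) p := inferInstanceAs (CharP K p)
      apply (LinearMap.liftBaseChangeEquiv (FrobExt p K) (R := K)).symm.injective
      apply Derivation.liftKaehlerDifferential_unique
      ext x
      have h : KaehlerDifferential.D k₀ (FrobExt p K) ((show FrobExt p K from x) ^ p) = 0 := by
        rw [Derivation.leibniz_pow, ← Nat.cast_smul_eq_nsmul (FrobExt p K), CharP.cast_eq_zero,
          zero_smul]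
      have h' : (1 : FrobExt p K) • KaehlerDifferential.D k₀ (FrobExt p K)
          ((show FrobExt p K from x) ^ p) = 0 := by rw [h, smul_zero]
      exact (KaehlerDifferential.mapBaseChange_tmul k₀ K (FrobExt p K) 1 _).trans
        ((congrArg _ (KaehlerDifferential.map_D k₀ k₀ K (FrobExt p K) x)).trans h')
    have h1 := KaehlerDifferential.exact_mapBaseChange_map k₀ K (FrobExt p K)
    rw [injective_iff_map_eq_zero]
    intro x hx
    obtain ⟨y, rfl⟩ := (h1 x).1 hx
    rw [h0, LinearMap.zero_apply])

end Kaehler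

section Points

variable {K : Type u} [Field K]

/-- The `K`-algebra of functions on a `K`-scheme. -/
def Fn (X : Over (Spec (.of K))) : Type u := Γ(X.left, ⊤)

instance (X : Over (Spec (.of K))) : CommRing (Fn X) := inferInstanceAs (CommRing Γ(X.left, ⊤))

instance (X : Over (Spec (.of K))) : Algebra K (Fn X) :=
  RingHom.toAlgebra (S := Γ(X.left, ⊤)) ((Scheme.ΓSpecIso (.of K)).inv ≫ X.hom.appTop).hom

/-- The pull-back of functions. -/
def Fn.comap {X Y : Over (Spec (.of K))} (f : X ⟶ Y) : Fn Y →ₐ[K] Fn X where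
  toRingHom := f.left.appTop.hom
  commutes' k := by
    have h : Y.hom.appTop ≫ f.left.appTop = X.hom.appTop := by
      rw [← Scheme.Hom.comp_appTop, Over.w]
    exact congrArg (fun g ↦ g.hom ((Scheme.ΓSpecIso (.of K)).inv.hom k)) h

variable {L L' : Type u} [CommRing L] [Algebra K L] [CommRing L'] [Algebra K L']

/-- The identification of the functions on `Spec L` with `L`. -/
def fnSpec (L : Type u) [CommRing L] [Algebra K L] : Fn (specOver (K := K) L) →ₐ[K] L where
  toRingHom := (Scheme.ΓSpecIso (.of L)).hom.hom
  commutes' k := by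
    have h : (Scheme.ΓSpecIso (.of K)).inv ≫
        (Spec.map (CommRingCat.ofHom (algebraMap K L))).appTop ≫ (Scheme.ΓSpecIso (.of L)).hom =
        CommRingCat.ofHom (algebraMap K L) := by
      rw [← Scheme.ΓSpecIso_inv_naturality_assoc, Iso.inv_hom_id, Category.comp_id]
    exact congrArg (fun g ↦ g.hom k) h

/-- The homomorphism `f ↦ f(x)` given by an `L`-valued point `x`. -/
def evalAt {X : Over (Spec (.of K))} (x : specOver (K := K) L ⟶ X) : Fn X →ₐ[K] L :=
  (fnSpec L).comp (Fn.comap x)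

lemma isoSpec_inv_appTop (X : Scheme.{u}) [IsAffine X] :
    X.isoSpec.inv.appTop = (Scheme.ΓSpecIso Γ(X, ⊤)).inv := by
  have h := congrArg Scheme.Hom.appTop X.isoSpec_inv_toSpecΓ
  rw [Scheme.Hom.comp_appTop, Scheme.toSpecΓ_appTop] at h
  exact ((Iso.eq_inv_comp _).2 h).trans (Category.comp_id _)

lemma specMap_comp_isoSpec_inv {X : Over (Spec (.of K))} [IsAffine X.left]
    (φ : Γ(X.left, ⊤) ⟶ .of L)
    (h : ((Scheme.ΓSpecIso (.of K)).inv ≫ X.hom.appTop) ≫ φ =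
      CommRingCat.ofHom (algebraMap K L)) :
    (Spec.map φ ≫ X.left.isoSpec.inv) ≫ X.hom =
      Spec.map (CommRingCat.ofHom (algebraMap K L)) := by
  apply ext_of_isAffine
  rw [← cancel_epi (Scheme.ΓSpecIso (.of K)).inv, ← Scheme.ΓSpecIso_inv_naturality, ← h]
  simp only [Scheme.Hom.comp_appTop, isoSpec_inv_appTop, Category.assoc]
  rw [← Scheme.ΓSpecIso_inv_naturality]

/-- The `L`-valued point of an affine scheme given by a homomorphism of algebras. -/
def pointOf {X : Over (Spec (.of K))} [IsAffine X.left] (φ : Fn X →ₐ[K] L) :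
    specOver (K := K) L ⟶ X :=
  Over.homMk (Spec.map (CommRingCat.ofHom (S := L) (R := Γ(X.left, ⊤)) φ.toRingHom) ≫
      X.left.isoSpec.inv) (specMap_comp_isoSpec_inv _ (by
    ext k
    exact φ.commutes k))

lemma evalAt_pointOf {X : Over (Spec (.of K))} [IsAffine X.left] (φ : Fn X →ₐ[K] L) :
    evalAt (pointOf φ) = φ := by
  have h : (Spec.map (CommRingCat.ofHom (S := L) (R := Γ(X.left, ⊤)) φ.toRingHom) ≫
      X.left.isoSpec.inv).appTop ≫ (Scheme.ΓSpecIso (.of L)).hom =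
      CommRingCat.ofHom (S := L) (R := Γ(X.left, ⊤)) φ.toRingHom := by
    simp only [Scheme.Hom.comp_appTop, isoSpec_inv_appTop, Category.assoc]
    rw [← Scheme.ΓSpecIso_inv_naturality_assoc, Iso.inv_hom_id, Category.comp_id]
  ext s
  exact congrArg (fun g ↦ g.hom s) h

lemma evalAt_injective {X : Over (Spec (.of K))} [IsAffine X.left]
    {x y : specOver (K := K) L ⟶ X} (h : evalAt x = evalAt y) : x = y := by
  ext : 1
  apply ext_of_isAffine
  let e : Γ((specOver (K := K) L).left, ⊤) ⟶ CommRingCat.of L := (Scheme.ΓSpecIso (.of L)).hom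
  have : IsIso e := inferInstanceAs (IsIso (Scheme.ΓSpecIso (.of L)).hom)
  rw [← cancel_mono e]
  ext s
  exact congrArg (fun φ ↦ φ s) h

lemma evalAt_comp {X Y : Over (Spec (.of K))} (x : specOver (K := K) L ⟶ X) (g : X ⟶ Y) :
    evalAt (x ≫ g) = (evalAt x).comp (Fn.comap g) := by
  have h : (x ≫ g).left.appTop = g.left.appTop ≫ x.left.appTop := by
    rw [Over.comp_left, Scheme.Hom.comp_appTop]
  ext s
  exact congrArg (fun φ ↦ fnSpec (K := K) L (φ.hom s)) h

lemma evalAt_specOverMap (f : L →ₐ[K] L') : evalAt (specOverMap f) = f.comp (fnSpec L) := by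
  have h := Scheme.ΓSpecIso_naturality (CommRingCat.ofHom f.toRingHom)
  ext s
  exact congrArg (fun φ ↦ φ.hom s) h

lemma evalAt_map {X : Over (Spec (.of K))} (f : L →ₐ[K] L') (x : specOver (K := K) L ⟶ X) :
    evalAt (specOverMap f ≫ x) = f.comp (evalAt x) := by
  rw [evalAt_comp, evalAt_specOverMap]
  rfl

end Points

section Phi

variable {K : Type u} [Field K]

section Omega

variable (G : Over (Spec (.of K))) [GrpObj G]

/-- The co-Lie algebra `ω_G = ε^* Ω_{G/K}` of an affine group scheme `G` over `K`, where `ε` is the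
unit section. -/
def omega : Type u := Cot (evalAt (1 : specOver (K := K) K ⟶ G))

instance : AddCommGroup (omega G) :=
  inferInstanceAs (AddCommGroup (Cot (evalAt (1 : specOver (K := K) K ⟶ G))))

instance : Module K (omega G) :=
  inferInstanceAs (Module K (Cot (evalAt (1 : specOver (K := K) K ⟶ G))))

variable {G} {H : Over (Spec (.of K))} [GrpObj H]

/-- The pull-back of differential forms `ω_H → ω_G` along a homomorphism `G ⟶ H`. -/
def omegaMap (f : G ⟶ H) [IsMonHom f] : omega H →ₗ[K] omega G :=
  Cot.comap (s := evalAt (1 : specOver (K := K) K ⟶ G))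
    (t := evalAt (1 : specOver (K := K) K ⟶ H)) (Fn.comap f) (by
      rw [← evalAt_comp, MonObj.one_comp])

variable [CharP K p]

variable (G) in
/-- The pull-back `F_K^* ω_G` of the co-Lie algebra along the Frobenius of `K`. -/
abbrev frobOmega : Type u := FrobExt p K ⊗[K] omega G

/-- The pull-back of differential forms `F_K^* ω_H → F_K^* ω_G` along a homomorphism `G ⟶ H`. -/
def frobOmegaMap (f : G ⟶ H) [IsMonHom f] :
    frobOmega p H →ₗ[FrobExt p K] frobOmega p G :=
  (omegaMap f).baseChange (FrobExt p K)

end Omega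

variable [CharP K p]

instance {A : Type u} [CommRing A] [Algebra K A] (s : A →ₐ[K] FrobExt p K) : Module K (Cot s) :=
  Module.compHom _ (algebraMap K (FrobExt p K))

instance {A : Type u} [CommRing A] [Algebra K A] (s : A →ₐ[K] FrobExt p K) :
    IsScalarTower K (FrobExt p K) (Cot s) := .of_algebraMap_smul fun _ _ ↦ rfl

namespace Torsor

variable {G : Over (Spec (.of K))} [GrpObj G] [IsHeightOne p G] (P : Torsor G)

/-- The homomorphism `f ↦ f(σ)`, where `σ` is the point of `P` over the Frobenius of `K`. -/
def frobEval : Fn P.X →ₐ[K] FrobExt p K := evalAt (P.frobPoint p)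

/-- The universal first order deformation `u` of the point `σ` of `P`, with values in the ring
`K^[1] ⊕ σ^* Ω_{P/K}`. -/
def univPoint : specOver (K := K) (SqZero (FrobExt p K) (Cot (P.frobEval p))) ⟶ P.X :=
  have := P.isAffine p
  pointOf (SqZero.univ (P.frobEval p))

/-- The point `σ` of `P`, viewed as a point with values in `K^[1] ⊕ σ^* Ω_{P/K}`. -/
def constPoint : specOver (K := K) (SqZero (FrobExt p K) (Cot (P.frobEval p))) ⟶ P.X :=
  specOverMap SqZero.inl ≫ P.frobPoint p

/-- The point `γ` of `G` with `γ • σ = u`, for the universal first order deformation `u` of `σ`. -/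
def univDiff : specOver (K := K) (SqZero (FrobExt p K) (Cot (P.frobEval p))) ⟶ G :=
  P.diff (P.univPoint p) (P.constPoint p)

lemma comp_diff {T T' : Over (Spec (.of K))} (x y : T ⟶ P.X) (f : T' ⟶ T) :
    f ≫ P.diff x y = P.diff (f ≫ x) (f ≫ y) := by
  simp only [diff, ← Category.assoc, comp_lift]

lemma specOverMap_fst_univDiff : specOverMap (SqZero.fst (K := K)) ≫ P.univDiff p = 1 := by
  have := P.isAffine p
  have h1 : specOverMap (SqZero.fst (K := K)) ≫ P.univPoint p = P.frobPoint p := by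
    apply evalAt_injective
    rw [evalAt_map, univPoint, evalAt_pointOf]
    rfl
  have h2 : specOverMap (SqZero.fst (K := K)) ≫ P.constPoint p = P.frobPoint p := by
    apply evalAt_injective
    rw [evalAt_map, constPoint, evalAt_map]
    rfl
  rw [univDiff, comp_diff, h1, h2, diff_eq_iff, one_smul]

lemma fst_univDiff (h : Fn G) : SqZero.fst (K := K) (evalAt (P.univDiff p) h) =
    algebraMap K (FrobExt p K) (evalAt (1 : specOver (K := K) K ⟶ G) h) := by
  have h1 := evalAt_map (SqZero.fst (K := K)) (P.univDiff p)
  rw [specOverMap_fst_univDiff] at h1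
  have h2 := evalAt_map (Algebra.ofId K (FrobExt p K)) (1 : specOver (K := K) K ⟶ G)
  rw [MonObj.comp_one, h1] at h2
  exact congrArg (fun φ ↦ φ h) h2

/-- The identification of `F_K^* ω_G` with `σ^* Ω_{P/K}` given by the trivialisation `γ ↦ γ • σ` of
the pull-back of `P` along the Frobenius of `K`: a function `h` on `G` vanishing at the unit yields
the differential at `σ` of the function `x ↦ h(γ)`, where `γ • σ = x`. -/
def trivialization : frobOmega p G →ₗ[FrobExt p K] Cot (P.frobEval p) :=
  LinearMap.liftBaseChange (FrobExt p K)
    (Cot.lift (s := evalAt (1 : specOver (K := K) K ⟶ G))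
      (fun h ↦ SqZero.snd (evalAt (P.univDiff p) h))
      (fun a b ↦ by rw [map_add, SqZero.snd_add])
      (fun k ↦ by rw [AlgHom.commutes, SqZero.snd_algebraMap])
      (fun a b ↦ by
        rw [map_mul, SqZero.snd_mul (K := K), fst_univDiff, fst_univDiff]
        rfl))

lemma trivialization_d (h : Fn G) :
    P.trivialization p ((1 : FrobExt p K) ⊗ₜ[K] (show omega G from Cot.d _ h)) =
      SqZero.snd (evalAt (P.univDiff p) h) := by
  refine (LinearMap.liftBaseChange_tmul _ _ _ _).trans ?_
  rw [one_smul]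
  exact Cot.lift_d _ _ _ _ _

variable (k₀ : Type u) [CommRing k₀] [Algebra k₀ K]

/-- The homomorphism `Φ(P) : F_K^* ω_G ≅ σ^* Ω_{P/K} ⟶ Ω_{F_K} ≅ Ω_{K^[1]/k₀}` given by the
differential of `σ`. -/
def Phi : frobOmega p G →ₗ[FrobExt p K] Ω[FrobExt p K⁄k₀] :=
  (kaehlerFrobEquiv p K k₀).symm.toLinearMap ∘ₗ Cot.toKaehler (P.frobEval p) ∘ₗ P.trivialization p

variable {P} {Q : Torsor G} (e : P.X ⟶ Q.X)

lemma frobEval_comp : (P.frobEval p).comp (Fn.comap e) = Q.frobEval p := by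
  rw [frobEval, ← evalAt_comp, Q.eq_frobPoint p (P.frobPoint p ≫ e)]
  rfl

lemma specOverMap_univPoint :
    specOverMap (SqZero.map (Cot.comap (Fn.comap e) (frobEval_comp p e))) ≫ Q.univPoint p =
      P.univPoint p ≫ e := by
  have := P.isAffine p
  have := Q.isAffine p
  apply evalAt_injective
  rw [evalAt_map, evalAt_comp, univPoint, univPoint, evalAt_pointOf, evalAt_pointOf]
  ext a
  refine SqZero.ext' (K := K) ?_ ?_
  · exact (congrArg (fun φ ↦ φ a) (frobEval_comp p e)).symm
  · exact Cot.comap_d _ (frobEval_comp p e) a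

lemma specOverMap_constPoint :
    specOverMap (SqZero.map (Cot.comap (Fn.comap e) (frobEval_comp p e))) ≫ Q.constPoint p =
      P.constPoint p ≫ e := by
  have := P.isAffine p
  have := Q.isAffine p
  apply evalAt_injective
  rw [evalAt_map, evalAt_comp, constPoint, constPoint, evalAt_map, evalAt_map]
  ext a
  refine SqZero.ext' (K := K) ?_ ?_
  · exact (congrArg (fun φ ↦ φ a) (frobEval_comp p e)).symm
  · exact map_zero (Cot.comap (Fn.comap e) (frobEval_comp p e))

lemma specOverMap_univDiff [IsModHom G e] :
    specOverMap (SqZero.map (Cot.comap (Fn.comap e) (frobEval_comp p e))) ≫ Q.univDiff p =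
      P.univDiff p := by
  rw [univDiff, comp_diff, specOverMap_univPoint, specOverMap_constPoint, diff_eq_iff]
  rw [← IsModHom.map_smul, univDiff, diff_smul]

lemma comap_trivialization [IsModHom G e] (w : frobOmega p G) :
    Cot.comap (Fn.comap e) (frobEval_comp p e) (Q.trivialization p w) =
      P.trivialization p w := by
  have : (Cot.comap (Fn.comap e) (frobEval_comp p e)).comp (Q.trivialization p) =
      P.trivialization p := by
    apply (LinearMap.liftBaseChangeEquiv (FrobExt p K) (R := K)).symm.injective
    apply Cot.ext
    intro h
    have h1 := trivialization_d p P h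
    have h2 := trivialization_d p Q h
    refine (congrArg (Cot.comap (Fn.comap e) (frobEval_comp p e)) h2).trans (Eq.trans ?_ h1.symm)
    rw [← specOverMap_univDiff p e, evalAt_map]
    rfl
  exact congrArg (fun f ↦ f w) this

lemma Phi_eq_of_isModHom [IsModHom G e] : P.Phi p k₀ = Q.Phi p k₀ := by
  refine LinearMap.ext fun w ↦ congrArg (kaehlerFrobEquiv p K k₀).symm ?_
  change Cot.toKaehler (P.frobEval p) (P.trivialization p w) =
    Cot.toKaehler (Q.frobEval p) (Q.trivialization p w)
  rw [← comap_trivialization p e, Cot.toKaehler_comap]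

end Torsor

/-- The map `Φ : H¹(K, G) ⟶ Hom_K(F_K^* ω_G, Ω_{K^[1]/k₀})`. -/
def Phi {G : Over (Spec (.of K))} [GrpObj G] [IsHeightOne p G] (k₀ : Type u) [CommRing k₀]
    [Algebra k₀ K] : H1 G → (frobOmega p G →ₗ[FrobExt p K] Ω[FrobExt p K⁄k₀]) :=
  Quotient.lift (fun P ↦ P.Phi p k₀) (fun _ _ ⟨e, _⟩ ↦ Torsor.Phi_eq_of_isModHom p k₀ e.hom)

end Phi

section Induced

variable {S : Scheme.{u}} {G G₁ : Over S} [GrpObj G] [GrpObj G₁]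

/-- The morphism `(γ, (x, z)) ↦ (γ⁻¹ • x, z * α(γ))`, for a `G`-torsor `P`, a homomorphism
`α : G ⟶ G₁` and points `γ`, `x`, `z` of `G`, `P`, `G₁`. -/
def inducedAct (α : G ⟶ G₁) (P : Torsor G) : G ⊗ (P.X ⊗ G₁) ⟶ P.X ⊗ G₁ :=
  lift ((fst G (P.X ⊗ G₁))⁻¹ • (snd G (P.X ⊗ G₁) ≫ fst P.X G₁))
    ((snd G (P.X ⊗ G₁) ≫ snd P.X G₁) * (fst G (P.X ⊗ G₁) ≫ α))

/-- The `G₁`-torsor `Q` is induced from the `G`-torsor `P` by the homomorphism `α : G ⟶ G₁`: it is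
the quotient of `P × G₁` by the action `γ • (x, z) = (γ⁻¹ • x, z * α(γ))` of `G`, in such a way that
the action of `G₁` on `Q` comes from the action of `G₁` by translation on the second factor. -/
structure IsInduced (α : G ⟶ G₁) (P : Torsor G) (Q : Torsor G₁) : Prop where
  exists_quotient : ∃ q : P.X ⊗ G₁ ⟶ Q.X,
    (∀ (T : Over S) (x : T ⟶ P.X) (z z' : T ⟶ G₁),
      lift x (z' * z) ≫ q = z' • (lift x z ≫ q)) ∧
    ∃ w : inducedAct α P ≫ q = snd G (P.X ⊗ G₁) ≫ q, Nonempty (IsColimit (Cofork.ofπ q w))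

end Induced

section Semiabelian

/-- An abelian variety over a field. -/
structure IsAbelianVariety {k : Type u} [Field k] (A : Over (Spec (.of k))) [GrpObj A] : Prop where
  isProper : IsProper A.hom
  smooth : Smooth A.hom
  geometricallyIntegral : GeometricallyIntegral A.hom

/-- A split torus over a field: a group scheme isomorphic to the spectrum of the Hopf algebra
`k[ℤ^n]`, for some `n`. -/
def IsSplitTorus {k : Type u} [Field k] (T : Over (Spec (.of k))) [GrpObj T] : Prop :=
  ∃ n : ℕ, Nonempty ((⟨T⟩ : Grp (Over (Spec (.of k)))) ≅
    (hopfSpec (.of k)).obj (op (.of k (AddMonoidAlgebra k (Fin n → ℤ)))))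

/-- A group scheme over an algebraically closed field which is an extension of an abelian variety
by a torus. -/
def IsSemiabelianVariety {k : Type u} [Field k] (G : Over (Spec (.of k))) [GrpObj G] : Prop :=
  ∃ (T A : Over (Spec (.of k))) (_ : GrpObj T) (_ : GrpObj A) (i : T ⟶ G) (q : G ⟶ A),
    IsSplitTorus T ∧ IsAbelianVariety A ∧ IsMonHom i ∧ IsMonHom q ∧
    IsPullback i (toUnit T) q η[A] ∧ Flat q.left ∧ Surjective q.left

/-- A semiabelian scheme over `V`: a smooth separated commutative group scheme whose geometric
fibres are extensions of abelian varieties by tori. -/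
structure IsSemiabelian {V : Scheme.{u}} (G : Over V) [GrpObj G] : Prop where
  isCommMonObj : IsCommMonObj G
  smooth : Smooth G.hom
  isSeparated : IsSeparated G.hom
  isSemiabelianVariety (k : Type u) [Field k] [IsAlgClosed k] (x : Spec (.of k) ⟶ V) :
    IsSemiabelianVariety ((Over.pullback x).obj G)

/-- An isogeny of height one: a surjective homomorphism with quasi-finite kernel, whose kernel is
of height one. -/
class IsHeightOneIsogeny {V : Scheme.{u}} [CharPScheme V p] {G H : Over V} [GrpObj G] [GrpObj H]
    (f : G ⟶ H) [IsMonHom f] : Prop where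
  surjective : Surjective f.left
  locallyQuasiFinite : LocallyQuasiFinite (ker f).hom
  isHeightOne : IsHeightOne p (ker f)

attribute [instance] IsHeightOneIsogeny.isHeightOne

end Semiabelian

section FunctionField

variable {k₀ : Type u} [Field k₀]

attribute [local instance] MvPolynomial.gradedAlgebra

/-- A scheme over `k₀` is quasi-projective if it admits an immersion into a projective space. -/
def IsQuasiProjective (V : Over (Spec (.of k₀))) : Prop :=
  ∃ (n : ℕ) (i : V.left ⟶ Proj (MvPolynomial.homogeneousSubmodule (Fin (n + 1)) k₀)),
    IsImmersion i ∧ i ≫ Proj.toSpecZero (MvPolynomial.homogeneousSubmodule (Fin (n + 1)) k₀) ≫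
      Spec.map (CommRingCat.ofHom
        (algebraMap k₀ (MvPolynomial.homogeneousSubmodule (Fin (n + 1)) k₀ 0))) = V.hom

variable (V : Over (Spec (.of k₀))) [IsIntegral V.left]

/-- The function field of an integral scheme over `k₀`. -/
def FunField : Type u := V.left.functionField

instance : Field (FunField V) := inferInstanceAs (Field V.left.functionField)

instance : Algebra k₀ (FunField V) :=
  RingHom.toAlgebra (S := V.left.functionField)
    ((Scheme.ΓSpecIso (.of k₀)).inv ≫ V.hom.appTop ≫ V.left.presheaf.germ ⊤ (genericPoint V.left) trivial).hom

instance [CharP k₀ p] : CharP (FunField V) p :=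
  charP_of_injective_algebraMap (algebraMap k₀ (FunField V)).injective p

/-- The generic point of `V`. -/
def genericPt : Spec (.of (FunField V)) ⟶ V.left := V.left.fromSpecStalk (genericPoint V.left)

/-- The base change to the function field of `V`. -/
abbrev genericFibre : Over V.left ⥤ Over (Spec (.of (FunField V))) := Over.pullback (genericPt V)

end FunctionField

end HeightOne

end

open HeightOne

/-! The homomorphism `α` exists by the universal property of the kernel: `ι₁ ∘ a = b ∘ ι₀` is
trivial on the kernel of `ι₀`.

The second assertion rests on replacing the quotient of `P × G₁` by simpler data: a `G₁`-torsor `Q`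
is induced from `P` exactly when there is a morphism `f : P ⟶ Q` with `f(γ • x) = α(γ) • f(x)`. From
a quotient map `q` one gets `f(x) = q(x, 1)` (`IsInduced.exists_isEquivariant`). Conversely, `f`
gives `(x, z) ↦ z • f(x)`, a base change of `P ⟶ S` up to isomorphism, hence an fppf cover of `Q`.
Two points with the same image differ by the action of `G`, so descent makes `Q` the quotient in the
category of all `S`-schemes (`isColimitOrbitMap`). Since quotients are unique, so is `Q` up to
equivariant isomorphism (`equiv_of_isEquivariant`).

Existence of `Q` is proved over a field, where groups of height one and their torsors are affine
(`exists_isEquivariant`). The candidate is the spectrum of the invariant functions on `P × G₁`.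
Every algebra over a field is flat, so this affine quotient commutes with products by affine
schemes. Therefore morphisms out of `T × Q` can be defined and compared on `T × (P × G₁)`. This
yields the action of `G₁`, and a function `c` on `P × Q` with `y = c(x, y) • f(x)`. Thus `Q` becomes
isomorphic to `G₁` after base change to `P`, and the torsor axioms other than flatness descend;
flatness is automatic over a field.

For `Φ`, an equivariant `f` sends the Frobenius point of `P` to that of `Q`, because the latter is
unique. It also transports the universal first order deformation of this point, and the group
element measuring the deformation is transported by `α`. So the trivialisations of the cotangent
spaces are compatible with pull-back along `f` and `α`
(`Torsor.comap_trivialization_of_isEquivariant`), and the chain rule for `f ∘ σ` gives the formula.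
-/

namespace HeightOne

/-! ### Equivariant morphisms of torsors and induced torsors -/

section Equivariant

variable {S : Scheme.{u}} {G G₁ : Over S} [GrpObj G] [GrpObj G₁]

/-- A morphism `f` between torsors under `G` and `G₁` is equivariant along `α : G ⟶ G₁` if
`f(γ • x) = α(γ) • f(x)`. -/
def IsEquivariant (α : G ⟶ G₁) {P : Torsor G} {Q : Torsor G₁} (f : P.X ⟶ Q.X) : Prop :=
  ∀ ⦃T : Over S⦄ (g : T ⟶ G) (x : T ⟶ P.X), (g • x) ≫ f = (g ≫ α) • (x ≫ f)

lemma Torsor.smul_right_cancel (P : Torsor G) {T : Over S} {g h : T ⟶ G} {x : T ⟶ P.X}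
    (H : g • x = h • x) : g = h :=
  (P.existsUnique (h • x) x).unique H rfl

lemma Torsor.diff_smul_self (P : Torsor G) {T : Over S} (g : T ⟶ G) (x : T ⟶ P.X) :
    P.diff (g • x) x = g :=
  (P.diff_eq_iff _ _ _).2 rfl

lemma Torsor.comp_diff' (P : Torsor G) {T T' : Over S} (f : T' ⟶ T) (x y : T ⟶ P.X) :
    f ≫ P.diff x y = P.diff (f ≫ x) (f ≫ y) := by
  simp only [diff, ← Category.assoc, comp_lift]

lemma lift_inducedAct (α : G ⟶ G₁) (P : Torsor G) {T : Over S} (g : T ⟶ G) (x : T ⟶ P.X)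
    (z : T ⟶ G₁) : lift g (lift x z) ≫ inducedAct α P = lift (g⁻¹ • x) (z * (g ≫ α)) := by
  simp [inducedAct, comp_lift, ModObj.comp_smul, MonObj.comp_mul, GrpObj.comp_inv]

lemma whiskerLeft_smul {X Y : Over S} [ModObj G Y] (q : X ⟶ Y) :
    G ◁ q ≫ γ[G, Y] = fst G X • (snd G X ≫ q) := by
  rw [Hom.smul_def]
  cat_disch

section Quotient

variable {P : Torsor G} {Q : Torsor G₁} (f : P.X ⟶ Q.X)

/-- The morphism `P × G₁ ⟶ Q`, `(x, z) ↦ z • f(x)`. -/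
noncomputable def orbitMap : P.X ⊗ G₁ ⟶ Q.X := snd P.X G₁ • (fst P.X G₁ ≫ f)

lemma lift_orbitMap {T : Over S} (x : T ⟶ P.X) (z : T ⟶ G₁) :
    lift x z ≫ orbitMap f = z • (x ≫ f) := by
  simp [orbitMap, ModObj.comp_smul]

/-- The isomorphism `P × G₁ ≅ P × Q`, `(x, z) ↦ (x, z • f(x))`. -/
noncomputable def orbitIso : P.X ⊗ G₁ ≅ P.X ⊗ Q.X where
  hom := lift (fst _ _) (orbitMap f)
  inv := lift (fst _ _) (Q.diff (snd _ _) (fst _ _ ≫ f))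
  hom_inv_id := by
    ext1
    · simp
    · simp [Torsor.comp_diff', orbitMap, Torsor.diff_smul_self]
  inv_hom_id := by
    ext1
    · simp
    · simp [lift_orbitMap, Torsor.diff_smul]

/-- Through `orbitIso` the orbit map becomes the projection `P × Q ⟶ Q`, the base change of `P ⟶ S`.
It is therefore flat, surjective and locally of finite presentation, hence an effective epimorphism.
-/
lemma isPullback_orbitMap :
    IsPullback (fst P.X G₁).left (orbitMap f).left P.X.hom Q.X.hom := by
  have h : IsPullback (fst P.X Q.X).left (snd P.X Q.X).left P.X.hom Q.X.hom :=
    IsPullback.of_hasPullback P.X.hom Q.X.hom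
  refine h.of_iso ((Over.forget S).mapIso (orbitIso f).symm) (.refl _) (.refl _) (.refl _)
    ?_ ?_ (by simp) (by simp)
  · change (fst P.X Q.X).left ≫ 𝟙 _ = ((orbitIso f).inv ≫ fst P.X G₁).left
    rw [Category.comp_id, orbitIso, lift_fst]
  · change (snd P.X Q.X).left ≫ 𝟙 _ = ((orbitIso f).inv ≫ orbitMap f).left
    rw [Category.comp_id, orbitIso, lift_orbitMap, Torsor.diff_smul]

instance : Flat (orbitMap f).left :=
  have := P.flat
  (MorphismProperty.of_isPullback (P := @Flat) (isPullback_orbitMap f) inferInstance)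

instance : Surjective (orbitMap f).left :=
  have := P.surjective
  (MorphismProperty.of_isPullback (P := @Surjective) (isPullback_orbitMap f) inferInstance)

instance : LocallyOfFinitePresentation (orbitMap f).left :=
  have := P.locallyOfFinitePresentation
  (MorphismProperty.of_isPullback (P := @LocallyOfFinitePresentation) (isPullback_orbitMap f)
    inferInstance)

lemma isPullback_whiskerLeft (T : Over S) {X Y : Over S} (g : X ⟶ Y) :
    IsPullback (T ◁ g).left (snd T X).left (snd T Y).left g.left := by
  refine IsPullback.of_right (h₁₂ := (fst T Y).left) (h₂₂ := Y.hom) (v₁₃ := T.hom) ?_ ?_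
    (IsPullback.of_hasPullback T.hom Y.hom)
  · rw [← Over.comp_left, whiskerLeft_fst, Over.w]
    exact IsPullback.of_hasPullback T.hom X.hom
  · rw [← Over.comp_left, ← Over.comp_left, whiskerLeft_snd]

/-- The product of `T` with the orbit map is a base change of the orbit map, so it is again an fppf
cover and an epimorphism. The case `T = G₁` serves to check equivariance of morphisms out of `Q`. -/
lemma cancel_whiskerLeft_orbitMap (T : Over S) {W : Over S} {g h : T ⊗ Q.X ⟶ W}
    (H : T ◁ orbitMap f ≫ g = T ◁ orbitMap f ≫ h) : g = h := by
  have := MorphismProperty.of_isPullback (P := @Flat)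
    (isPullback_whiskerLeft T (orbitMap f)).flip inferInstance
  have := MorphismProperty.of_isPullback (P := @Surjective)
    (isPullback_whiskerLeft T (orbitMap f)).flip inferInstance
  have := MorphismProperty.of_isPullback (P := @LocallyOfFinitePresentation)
    (isPullback_whiskerLeft T (orbitMap f)).flip inferInstance
  ext1
  rw [← cancel_epi (T ◁ orbitMap f).left]
  exact congrArg (fun t ↦ t.left) H

variable {f}

/-- The fibres of the orbit map are the orbits of `G`. If `z • f(x) = z' • f(x')` and `x = g • x'`,
then `z * α(g) = z'` by simple transitivity, so `g` moves `(x, z)` to `(x', z')`. -/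
lemma comp_eq_of_comp_orbitMap_eq {α : G ⟶ G₁} (hf : IsEquivariant α f) {W : Over S}
    {k : P.X ⊗ G₁ ⟶ W} (hk : inducedAct α P ≫ k = snd G (P.X ⊗ G₁) ≫ k) {T : Over S}
    {y y' : T ⟶ P.X ⊗ G₁} (h : y ≫ orbitMap f = y' ≫ orbitMap f) : y ≫ k = y' ≫ k := by
  obtain ⟨x, z, rfl⟩ : ∃ x z, y = lift x z := ⟨y ≫ fst _ _, y ≫ snd _ _, by simp⟩
  obtain ⟨x', z', rfl⟩ : ∃ x z, y' = lift x z := ⟨y' ≫ fst _ _, y' ≫ snd _ _, by simp⟩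
  rw [lift_orbitMap, lift_orbitMap] at h
  have h1 : z * (P.diff x x' ≫ α) = z' := by
    apply Q.smul_right_cancel (x := x' ≫ f)
    rw [mul_smul, ← hf, P.diff_smul, h]
  have h2 : (P.diff x x')⁻¹ • x = x' := by
    rw [inv_smul_eq_iff, P.diff_smul]
  have h3 := congrArg (fun t ↦ lift (P.diff x x') (lift x z) ≫ t) hk
  simp only [← Category.assoc, lift_inducedAct, h1, h2, lift_snd] at h3
  exact h3.symm

lemma inducedAct_orbitMap {α : G ⟶ G₁} (hf : IsEquivariant α f) :
    inducedAct α P ≫ orbitMap f = snd G (P.X ⊗ G₁) ≫ orbitMap f := by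
  have h : 𝟙 (G ⊗ (P.X ⊗ G₁)) = lift (fst _ _) (lift (snd _ _ ≫ fst _ _) (snd _ _ ≫ snd _ _)) := by
    simp [← comp_lift]
  rw [← Category.id_comp (inducedAct α P), ← Category.id_comp (snd G (P.X ⊗ G₁)), h,
    lift_inducedAct, lift_orbitMap, lift_snd, lift_orbitMap, mul_smul, ← hf, smul_inv_smul]

/-- The torsor `Q` is the quotient of `P × G₁`, if there is an equivariant morphism `P ⟶ Q`. -/
noncomputable def isColimitOrbitMap {α : G ⟶ G₁} (hf : IsEquivariant α f) :
    IsColimit (Cofork.ofπ (orbitMap f) (inducedAct_orbitMap hf)) := by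
  have key (s : Cofork (inducedAct α P) (snd G (P.X ⊗ G₁))) {Z : Scheme.{u}}
      (g₁ g₂ : Z ⟶ (P.X ⊗ G₁).left) (h : g₁ ≫ (orbitMap f).left = g₂ ≫ (orbitMap f).left) :
      g₁ ≫ s.π.left = g₂ ≫ s.π.left := by
    -- Descent tests on arbitrary schemes `Z`. As the orbit map lies over `S`, `g₁` and `g₂` induce
    -- the same structure morphism on `Z`, so they are points of `P × G₁` over `S`.
    have h0 : g₂ ≫ (P.X ⊗ G₁).hom = g₁ ≫ (P.X ⊗ G₁).hom := by
      rw [← Over.w (orbitMap f), reassoc_of% h]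
    let y₁ : Over.mk (g₁ ≫ (P.X ⊗ G₁).hom) ⟶ P.X ⊗ G₁ := Over.homMk g₁
    let y₂ : Over.mk (g₁ ≫ (P.X ⊗ G₁).hom) ⟶ P.X ⊗ G₁ := Over.homMk g₂ h0
    exact congrArg (fun t ↦ t.left) (comp_eq_of_comp_orbitMap_eq hf s.condition
      (y := y₁) (y' := y₂) (Over.OverMorphism.ext h))
  refine Cofork.IsColimit.mk _
    (fun s ↦ Over.homMk (EffectiveEpi.desc (orbitMap f).left s.π.left (key s)) ?_) ?_ ?_
  · rw [← cancel_epi (orbitMap f).left, EffectiveEpi.fac_assoc]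
    exact (Over.w s.π).trans (Over.w (orbitMap f)).symm
  · intro s
    ext1
    exact EffectiveEpi.fac (orbitMap f).left s.π.left (key s)
  · intro s m hm
    ext1
    rw [← cancel_epi (orbitMap f).left]
    exact (congrArg (fun t ↦ t.left) hm).trans
      (EffectiveEpi.fac (orbitMap f).left s.π.left (key s)).symm

lemma isInduced_of_isEquivariant {α : G ⟶ G₁} (hf : IsEquivariant α f) : IsInduced α P Q where
  exists_quotient := ⟨orbitMap f, fun T x z z' ↦ by rw [lift_orbitMap, lift_orbitMap, mul_smul],
    inducedAct_orbitMap hf, ⟨isColimitOrbitMap hf⟩⟩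

end Quotient

lemma IsInduced.exists_isEquivariant {α : G ⟶ G₁} [IsMonHom α] {P : Torsor G} {Q : Torsor G₁}
    (h : IsInduced α P Q) : ∃ f : P.X ⟶ Q.X, IsEquivariant α f := by
  obtain ⟨q, h1, h2, -⟩ := h.exists_quotient
  -- The morphism is `f(x) = q(x, 1)`. Since `g` moves `(g • x, 1)` to `(x, α(g))`, invariance of
  -- `q` gives `f(g • x) = q(x, α(g)) = α(g) • f(x)`.
  refine ⟨lift (𝟙 _) 1 ≫ q, fun T g x ↦ ?_⟩
  have h3 := congrArg (fun t ↦ lift g (lift (g • x) 1) ≫ t) h2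
  simp only [← Category.assoc, lift_inducedAct, inv_smul_smul, lift_snd, one_mul] at h3
  rw [← Category.assoc, ← Category.assoc, comp_lift, comp_lift, Category.comp_id, Category.comp_id,
    MonObj.comp_one, MonObj.comp_one, ← h3, ← h1, mul_one]

/-- Torsors induced from the same torsor are isomorphic. -/
lemma equiv_of_isEquivariant {α : G ⟶ G₁} {P : Torsor G} {Q Q' : Torsor G₁} {f : P.X ⟶ Q.X}
    {f' : P.X ⟶ Q'.X} (hf : IsEquivariant α f) (hf' : IsEquivariant α f') : Q ≈ Q' := by
  let e : Q.X ≅ Q'.X := (isColimitOrbitMap hf).coconePointUniqueUpToIso (isColimitOrbitMap hf')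
  have he : orbitMap f ≫ e.hom = orbitMap f' :=
    (isColimitOrbitMap hf).comp_coconePointUniqueUpToIso_hom (isColimitOrbitMap hf') .one
  -- After pull-back to `G₁ × (P × G₁)`, both sides of the equivariance of `e` become `(z' * z) •
  -- f'(x)`.
  refine ⟨e, ⟨cancel_whiskerLeft_orbitMap f G₁ ?_⟩⟩
  change G₁ ◁ orbitMap f ≫ γ[G₁, Q.X] ≫ e.hom = G₁ ◁ orbitMap f ≫ G₁ ◁ e.hom ≫ γ[G₁, Q'.X]
  have h1 : G₁ ◁ orbitMap f ≫ γ[G₁, Q.X] =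
      lift (snd G₁ (P.X ⊗ G₁) ≫ fst _ _) (fst _ _ * (snd _ _ ≫ snd _ _)) ≫ orbitMap f := by
    rw [whiskerLeft_smul, lift_orbitMap, mul_smul, orbitMap, ModObj.comp_smul, Category.assoc]
  rw [reassoc_of% h1, he, lift_orbitMap, mul_smul, ← whiskerLeft_comp_assoc, he, whiskerLeft_smul,
    orbitMap, ModObj.comp_smul, Category.assoc]

end Equivariant

/-! ### Compatibility of `Φ` with equivariant morphisms -/

section Phi

variable (p : ℕ) [hp : Fact p.Prime] {K : Type u} [Field K] [CharP K p]
  {G G₁ : Over (Spec (.of K))} [GrpObj G] [GrpObj G₁] [IsHeightOne p G] [IsHeightOne p G₁]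

namespace Torsor

variable {P : Torsor G} {Q : Torsor G₁} {e : P.X ⟶ Q.X} {α : G ⟶ G₁}

/-- `Q` has only one point over the Frobenius of `K`, so any morphism of `K`-schemes, equivariant or
not, maps `σ` of `P` to `σ` of `Q`. -/
lemma frobEval_comp_of_hom (e : P.X ⟶ Q.X) :
    (P.frobEval p).comp (Fn.comap e) = Q.frobEval p := by
  rw [frobEval, ← evalAt_comp, Q.eq_frobPoint p (P.frobPoint p ≫ e)]
  rfl

/-- The image under `e` of the universal deformation of `σ` on `P` is a deformation of `σ` on `Q`,
classified by the pull-back of differentials: a function `a` on `Q` takes on both sides the value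
with components `a(e(σ))` and `d(a ∘ e)`. -/
lemma specOverMap_univPoint_of_hom (e : P.X ⟶ Q.X) :
    specOverMap (SqZero.map (Cot.comap (Fn.comap e) (frobEval_comp_of_hom p e))) ≫
      Q.univPoint p = P.univPoint p ≫ e := by
  have := P.isAffine p
  have := Q.isAffine p
  apply evalAt_injective
  rw [evalAt_map, evalAt_comp, univPoint, univPoint, evalAt_pointOf, evalAt_pointOf]
  ext a
  refine SqZero.ext' (K := K) ?_ ?_
  · exact (congrArg (fun φ ↦ φ a) (frobEval_comp_of_hom p e)).symm
  · exact Cot.comap_d _ (frobEval_comp_of_hom p e) a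

lemma specOverMap_constPoint_of_hom (e : P.X ⟶ Q.X) :
    specOverMap (SqZero.map (Cot.comap (Fn.comap e) (frobEval_comp_of_hom p e))) ≫
      Q.constPoint p = P.constPoint p ≫ e := by
  have := P.isAffine p
  have := Q.isAffine p
  apply evalAt_injective
  rw [evalAt_map, evalAt_comp, constPoint, constPoint, evalAt_map, evalAt_map]
  ext a
  refine SqZero.ext' (K := K) ?_ ?_
  · exact (congrArg (fun φ ↦ φ a) (frobEval_comp_of_hom p e)).symm
  · exact map_zero (Cot.comap (Fn.comap e) (frobEval_comp_of_hom p e))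

/-- Applying `e` to `γ • σ = u` on `P` gives `α(γ) • e(σ) = e(u)`. Here `e(σ)` and `e(u)` are
specialisations of the corresponding points of `Q`, and simple transitivity identifies `α(γ)`. -/
lemma specOverMap_univDiff_of_isEquivariant (he : IsEquivariant α e) :
    specOverMap (SqZero.map (Cot.comap (Fn.comap e) (frobEval_comp_of_hom p e))) ≫
      Q.univDiff p = P.univDiff p ≫ α := by
  rw [univDiff, comp_diff, specOverMap_univPoint_of_hom, specOverMap_constPoint_of_hom,
    diff_eq_iff, ← he, univDiff, diff_smul]

lemma comap_trivialization_of_isEquivariant [IsMonHom α] (he : IsEquivariant α e)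
    (w : frobOmega p G₁) :
    Cot.comap (Fn.comap e) (frobEval_comp_of_hom p e) (Q.trivialization p w) =
      P.trivialization p (frobOmegaMap p α w) := by
  have : (Cot.comap (Fn.comap e) (frobEval_comp_of_hom p e)).comp (Q.trivialization p) =
      (P.trivialization p).comp (frobOmegaMap p α) := by
    -- Both sides are linear on the base change of a module generated by differentials `dh`, so it
    -- is enough to compare them on `1 ⊗ dh`.
    apply (LinearMap.liftBaseChangeEquiv (FrobExt p K) (R := K)).symm.injective
    apply Cot.ext
    intro h
    have h1 := trivialization_d p P (Fn.comap α h)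
    have h2 := trivialization_d p Q h
    have h3 : frobOmegaMap p α ((1 : FrobExt p K) ⊗ₜ[K] (show omega G₁ from Cot.d _ h)) =
        (1 : FrobExt p K) ⊗ₜ[K] (show omega G from Cot.d _ (Fn.comap α h)) := by
      refine (LinearMap.baseChange_tmul _ _ _).trans ?_
      congr 1
      exact Cot.comap_d _ _ _
    refine (congrArg (Cot.comap (Fn.comap e) (frobEval_comp_of_hom p e)) h2).trans
      (Eq.trans ?_ (h1.symm.trans (congrArg (P.trivialization p) h3.symm)))
    have h4 := congrArg (fun φ ↦ SqZero.snd (evalAt φ h))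
      (specOverMap_univDiff_of_isEquivariant p he)
    rw [evalAt_map, evalAt_comp] at h4
    exact h4
  exact congrArg (fun f ↦ f w) this

/-- By the chain rule for `e(σ)`, the differential of `σ` on `Q` is the pull-back along `e` followed
by the differential of `σ` on `P`; compatibility of the trivialisations does the rest. -/
lemma Phi_of_isEquivariant [IsMonHom α] (k₀ : Type u) [CommRing k₀] [Algebra k₀ K]
    (he : IsEquivariant α e) (w : frobOmega p G₁) :
    Q.Phi p k₀ w = P.Phi p k₀ (frobOmegaMap p α w) := by
  refine congrArg (kaehlerFrobEquiv p K k₀).symm ?_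
  change Cot.toKaehler (Q.frobEval p) (Q.trivialization p w) =
    Cot.toKaehler (P.frobEval p) (P.trivialization p (frobOmegaMap p α w))
  rw [← comap_trivialization_of_isEquivariant p he, Cot.toKaehler_comap]

end Torsor

end Phi

/-! ### Affine quotients over a field through algebras of functions -/

section Functions

variable {K : Type u} [Field K]

lemma Fn.comap_comp {X Y Z : Over (Spec (.of K))} (f : X ⟶ Y) (g : Y ⟶ Z) :
    Fn.comap (f ≫ g) = (Fn.comap f).comp (Fn.comap g) := by
  ext s
  have h : (f ≫ g).left.appTop = g.left.appTop ≫ f.left.appTop := by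
    rw [Over.comp_left, Scheme.Hom.comp_appTop]
  exact congrArg (fun φ ↦ φ.hom s) h

lemma Fn.comap_injective {X Y : Over (Spec (.of K))} [IsAffine Y.left] {f g : X ⟶ Y}
    (h : Fn.comap f = Fn.comap g) : f = g := by
  ext1
  apply ext_of_isAffine
  ext s
  exact congrArg (fun φ ↦ φ s) h

/-- The morphism to an affine scheme given by a homomorphism of algebras of functions. -/
noncomputable def homOfFn {X Y : Over (Spec (.of K))} [IsAffine Y.left] (φ : Fn Y →ₐ[K] Fn X) :
    X ⟶ Y :=
  Over.homMk (X.left.toSpecΓ ≫ Spec.map (CommRingCat.ofHom (R := Γ(Y.left, ⊤)) (S := Γ(X.left, ⊤))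
      φ.toRingHom) ≫ Y.left.isoSpec.inv) (by
    apply ext_of_isAffine
    rw [← cancel_epi (Scheme.ΓSpecIso (.of K)).inv]
    simp only [Scheme.Hom.comp_appTop, isoSpec_inv_appTop, Category.assoc, Scheme.toSpecΓ_appTop]
    rw [← Scheme.ΓSpecIso_inv_naturality_assoc, Iso.inv_hom_id, Category.comp_id]
    ext k
    exact φ.commutes k)

lemma comap_homOfFn {X Y : Over (Spec (.of K))} [IsAffine Y.left] (φ : Fn Y →ₐ[K] Fn X) :
    Fn.comap (homOfFn φ) = φ := by
  have h : (homOfFn φ).left.appTop = CommRingCat.ofHom (R := Γ(Y.left, ⊤)) (S := Γ(X.left, ⊤))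
      φ.toRingHom := by
    simp only [homOfFn, Over.homMk_left, Scheme.Hom.comp_appTop, isoSpec_inv_appTop, Category.assoc,
      Scheme.toSpecΓ_appTop]
    rw [← Scheme.ΓSpecIso_inv_naturality_assoc, Iso.inv_hom_id, Category.comp_id]
  ext s
  exact congrArg (fun φ ↦ φ.hom s) h

instance (X Y : Over (Spec (.of K))) [IsAffine X.left] [IsAffine Y.left] : IsAffine (X ⊗ Y).left :=
  inferInstanceAs (IsAffine (pullback X.hom Y.hom))

/-- The homomorphism `s ⊗ t ↦ s(x) t(y)` from `Fn X ⊗ Fn Y` to the functions on `X × Y`. -/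
noncomputable def prodFn (X Y : Over (Spec (.of K))) : Fn X ⊗[K] Fn Y →ₐ[K] Fn (X ⊗ Y) :=
  Algebra.TensorProduct.productMap (Fn.comap (fst X Y)) (Fn.comap (snd X Y))

lemma prodFn_tmul {X Y : Over (Spec (.of K))} (s : Fn X) (t : Fn Y) :
    prodFn X Y (s ⊗ₜ t) = Fn.comap (fst X Y) s * Fn.comap (snd X Y) t := rfl

lemma prodFn_bijective (X Y : Over (Spec (.of K))) [IsAffine X.left] [IsAffine Y.left] :
    Function.Bijective (prodFn X Y) := by
  let _ : Algebra (Fn X) (Fn (X ⊗ Y)) := (Fn.comap (fst X Y)).toAlgebra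
  let _ : Algebra (Fn Y) (Fn (X ⊗ Y)) := (Fn.comap (snd X Y)).toAlgebra
  have : IsScalarTower K (Fn X) (Fn (X ⊗ Y)) :=
    .of_algebraMap_eq fun k ↦ ((Fn.comap (fst X Y)).commutes k).symm
  have : IsScalarTower K (Fn Y) (Fn (X ⊗ Y)) :=
    .of_algebraMap_eq fun k ↦ ((Fn.comap (snd X Y)).commutes k).symm
  have h0 := isPushout_appTop_of_isPullback (IsPullback.of_hasPullback X.hom Y.hom)
  have h1 : IsPushout (CommRingCat.ofHom (algebraMap K (Fn X)))
      (CommRingCat.ofHom (algebraMap K (Fn Y)))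
      (CommRingCat.ofHom (algebraMap (Fn X) (Fn (X ⊗ Y))))
      (CommRingCat.ofHom (algebraMap (Fn Y) (Fn (X ⊗ Y)))) :=
    -- The square of global sections has `Γ(Spec K)` in its corner; this replaces it by `K`.
    h0.of_iso (Scheme.ΓSpecIso (.of K)) (.refl _) (.refl _) (.refl _)
      ((Category.comp_id X.hom.appTop).trans
        (Iso.hom_inv_id_assoc (Scheme.ΓSpecIso (.of K)) X.hom.appTop).symm)
      ((Category.comp_id Y.hom.appTop).trans
        (Iso.hom_inv_id_assoc (Scheme.ΓSpecIso (.of K)) Y.hom.appTop).symm)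
      rfl rfl
  have h2 : Algebra.IsPushout K (Fn X) (Fn Y) (Fn (X ⊗ Y)) :=
    CommRingCat.isPushout_iff_isPushout.1 h1
  have h3 : ⇑(prodFn X Y) = Algebra.IsPushout.equiv K (Fn X) (Fn Y) (Fn (X ⊗ Y)) := by
    funext z
    induction z with
    | zero => simp
    | add x y hx hy => simp only [map_add, hx, hy]
    | tmul s t => rw [Algebra.IsPushout.equiv_tmul]; rfl
  rw [h3]
  exact AlgEquiv.bijective _

lemma comap_whiskerLeft_prodFn (T : Over (Spec (.of K))) {X Y : Over (Spec (.of K))} (f : X ⟶ Y)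
    (z : Fn T ⊗[K] Fn Y) : Fn.comap (T ◁ f) (prodFn T Y z) =
      prodFn T X (LinearMap.lTensor (Fn T) (Fn.comap f).toLinearMap z) := by
  induction z with
  | zero => simp
  | add x y hx hy => simp only [map_add, hx, hy]
  | tmul s t =>
    rw [LinearMap.lTensor_tmul, prodFn_tmul, map_mul, prodFn_tmul, ← AlgHom.comp_apply,
      ← AlgHom.comp_apply, ← Fn.comap_comp, ← Fn.comap_comp, whiskerLeft_fst, whiskerLeft_snd,
      Fn.comap_comp]
    rfl

/-- The functions on `Q` are the functions on `X` with the same pull-back along `u` and `v`. -/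
structure IsFnEqualizer {X Y Q : Over (Spec (.of K))} (u v : Y ⟶ X) (q : X ⟶ Q) : Prop where
  injective : Function.Injective (Fn.comap q)
  exact : Function.Exact (Fn.comap q).toLinearMap
    ((Fn.comap u).toLinearMap - (Fn.comap v).toLinearMap)

namespace IsFnEqualizer

variable {X Y Q : Over (Spec (.of K))} {u v : Y ⟶ X} {q : X ⟶ Q}

lemma condition [IsAffine Q.left] (h : IsFnEqualizer u v q) : u ≫ q = v ≫ q := by
  apply Fn.comap_injective
  ext a
  rw [Fn.comap_comp, Fn.comap_comp]
  have := (h.exact (Fn.comap q a)).2 ⟨a, rfl⟩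
  exact sub_eq_zero.1 this

/-- For affine `W`, invariance of `g` says that `g` pulls functions back into the equalizer, which
is the algebra of functions on `Q`. This is the universal property of the quotient, for affine
targets only. -/
lemma existsUnique (h : IsFnEqualizer u v q) {W : Over (Spec (.of K))} [IsAffine W.left]
    (g : X ⟶ W) (hg : u ≫ g = v ≫ g) : ∃! k : Q ⟶ W, q ≫ k = g := by
  have h1 (w : Fn W) : Fn.comap g w ∈ (Fn.comap q).range := by
    refine (h.exact (Fn.comap g w)).1 ?_
    refine sub_eq_zero.2 ?_
    have := congrArg (fun φ ↦ Fn.comap φ w) hg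
    simp only [Fn.comap_comp] at this
    exact this
  let e := AlgEquiv.ofInjective (Fn.comap q) h.injective
  refine ⟨homOfFn (e.symm.toAlgHom.comp ((Fn.comap g).codRestrict _ h1)), ?_, fun k hk ↦ ?_⟩
  · apply Fn.comap_injective
    rw [Fn.comap_comp, comap_homOfFn]
    ext w
    exact congrArg Subtype.val (e.apply_symm_apply ((Fn.comap g).codRestrict _ h1 w))
  · apply Fn.comap_injective
    rw [comap_homOfFn]
    ext w
    apply h.injective
    rw [← AlgHom.comp_apply, ← Fn.comap_comp, hk]
    exact (congrArg Subtype.val (e.apply_symm_apply ((Fn.comap g).codRestrict _ h1 w))).symm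

/-- `Fn T` is flat over the field `K`, so tensoring with it preserves the left exact sequence formed
by `Fn Q`, `Fn X` and `Fn Y`. -/
lemma whiskerLeft (h : IsFnEqualizer u v q) (T : Over (Spec (.of K))) [IsAffine T.left]
    [IsAffine X.left] [IsAffine Y.left] [IsAffine Q.left] :
    IsFnEqualizer (T ◁ u) (T ◁ v) (T ◁ q) := by
  have h1 : ∀ z, Fn.comap (T ◁ q) (prodFn T Q z) = _ := comap_whiskerLeft_prodFn T q
  constructor
  · intro x y hxy
    obtain ⟨x, rfl⟩ := (prodFn_bijective T Q).2 x
    obtain ⟨y, rfl⟩ := (prodFn_bijective T Q).2 y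
    rw [h1, h1] at hxy
    exact congrArg _ (Module.Flat.lTensor_preserves_injective_linearMap (M := Fn T) _ h.injective
      ((prodFn_bijective T X).1 hxy))
  · intro x
    obtain ⟨x, rfl⟩ := (prodFn_bijective T X).2 x
    have h2 := Module.Flat.lTensor_exact (Fn T) h.exact x
    rw [LinearMap.lTensor_sub] at h2
    rw [LinearMap.sub_apply, AlgHom.toLinearMap_apply, AlgHom.toLinearMap_apply,
      comap_whiskerLeft_prodFn, comap_whiskerLeft_prodFn, ← map_sub,
      (injective_iff_map_eq_zero' _).1 (prodFn_bijective T Y).1, ← LinearMap.sub_apply, h2]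
    constructor
    · rintro ⟨y, rfl⟩
      exact ⟨prodFn T Q y, h1 y⟩
    · rintro ⟨y, hy⟩
      obtain ⟨y, rfl⟩ := (prodFn_bijective T Q).2 y
      exact ⟨y, (prodFn_bijective T X).1 ((h1 y).symm.trans hy)⟩

end IsFnEqualizer

lemma exists_isFnEqualizer {X Y : Over (Spec (.of K))} (u v : Y ⟶ X) :
    ∃ (Q : Over (Spec (.of K))) (_ : IsAffine Q.left) (q : X ⟶ Q), IsFnEqualizer u v q := by
  let B := AlgHom.equalizer (Fn.comap u) (Fn.comap v)
  have hB : IsAffine (specOver (K := K) B).left := inferInstanceAs (IsAffine (Spec (.of B)))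
  have hb : Function.Bijective (fnSpec (K := K) B) :=
    ConcreteCategory.bijective_of_isIso (Scheme.ΓSpecIso (.of B)).hom
  refine ⟨specOver B, hB, homOfFn (B.val.comp (fnSpec B)), ?_, ?_⟩
  · rw [comap_homOfFn]
    exact Subtype.val_injective.comp hb.1
  · rw [comap_homOfFn]
    intro x
    refine sub_eq_zero.trans ⟨fun h ↦ ?_, ?_⟩
    · obtain ⟨a, ha⟩ := hb.2 ⟨x, h⟩
      exact ⟨a, congrArg Subtype.val ha⟩
    · rintro ⟨a, rfl⟩
      exact (fnSpec (K := K) B a).2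

end Functions

/-! ### Existence of the induced torsor over a field -/

section Existence

variable {K : Type u} [Field K] {G G₁ : Over (Spec (.of K))} [GrpObj G] [GrpObj G₁]
  {α : G ⟶ G₁} {P : Torsor G} {Q : Over (Spec (.of K))} {q : P.X ⊗ G₁ ⟶ Q}

lemma lift_smul_comp_of_inducedAct_comp
    (hq : inducedAct α P ≫ q = snd G (P.X ⊗ G₁) ≫ q) {T : Over (Spec (.of K))} (g : T ⟶ G)
    (x : T ⟶ P.X) (z : T ⟶ G₁) : lift (g • x) z ≫ q = lift x (z * (g ≫ α)) ≫ q := by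
  have h := congrArg (fun t ↦ lift g (lift (g • x) z) ≫ t) hq
  simp only [← Category.assoc, lift_inducedAct, inv_smul_smul, lift_snd] at h
  exact h.symm

namespace IsFnEqualizer

variable [IsAffine G.left] [IsAffine G₁.left] [IsAffine P.X.left] [IsAffine Q.left]

/-- `T × Q` is an affine quotient of `T × (P × G₁)`, so equality can be checked on points `(t, q(x,
z))`; the proof uses the universal such point. -/
lemma hom_ext_of_lift (hq : IsFnEqualizer (inducedAct α P) (snd G (P.X ⊗ G₁)) q)
    {T W : Over (Spec (.of K))} [IsAffine T.left] [IsAffine W.left]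
    {g h : T ⊗ Q ⟶ W}
    (H : ∀ (T' : Over (Spec (.of K))) (t : T' ⟶ T) (x : T' ⟶ P.X) (z : T' ⟶ G₁),
      lift t (lift x z ≫ q) ≫ g = lift t (lift x z ≫ q) ≫ h) : g = h := by
  have h1 : T ◁ q ≫ g = T ◁ q ≫ h := by
    have := H (T ⊗ (P.X ⊗ G₁)) (fst _ _) (snd _ _ ≫ fst _ _) (snd _ _ ≫ snd _ _)
    have h2 : lift (snd T (P.X ⊗ G₁) ≫ fst _ _) (snd T (P.X ⊗ G₁) ≫ snd _ _) =
      snd T (P.X ⊗ G₁) := by simp [← comp_lift]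
    have h3 : lift (fst T (P.X ⊗ G₁)) (snd T (P.X ⊗ G₁) ≫ q) = T ◁ q := by
      ext1 <;> simp
    rwa [h2, h3] at this
  refine ((hq.whiskerLeft T).existsUnique (T ◁ q ≫ h) ?_).unique h1 rfl
  rw [← whiskerLeft_comp_assoc, hq.condition, whiskerLeft_comp_assoc]

/-- The hypothesis `H`, at the universal point of `T × (G × (P × G₁))`, is the invariance of `g`
under `G`, which lets `g` descend to `T × Q`. -/
lemma exists_lift_comp (hq : IsFnEqualizer (inducedAct α P) (snd G (P.X ⊗ G₁)) q)
    {T W : Over (Spec (.of K))} [IsAffine T.left] [IsAffine W.left]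
    (g : T ⊗ (P.X ⊗ G₁) ⟶ W)
    (H : ∀ (T' : Over (Spec (.of K))) (t : T' ⟶ T) (c : T' ⟶ G) (x : T' ⟶ P.X) (z : T' ⟶ G₁),
      lift t (lift (c⁻¹ • x) (z * (c ≫ α))) ≫ g = lift t (lift x z) ≫ g) :
    ∃ k : T ⊗ Q ⟶ W, ∀ (T' : Over (Spec (.of K))) (t : T' ⟶ T) (x : T' ⟶ P.X) (z : T' ⟶ G₁),
      lift t (lift x z ≫ q) ≫ k = lift t (lift x z) ≫ g := by
  obtain ⟨k, hk, -⟩ := (hq.whiskerLeft T).existsUnique g (by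
    have := H (T ⊗ (G ⊗ (P.X ⊗ G₁))) (fst _ _) (snd _ _ ≫ fst _ _) (snd _ _ ≫ snd _ _ ≫ fst _ _)
      (snd _ _ ≫ snd _ _ ≫ snd _ _)
    have h2 : lift (snd T (G ⊗ (P.X ⊗ G₁)) ≫ snd _ _ ≫ fst _ _)
      (snd T (G ⊗ (P.X ⊗ G₁)) ≫ snd _ _ ≫ snd _ _) = snd T (G ⊗ (P.X ⊗ G₁)) ≫ snd _ _ := by
      simp [← comp_lift]
    rw [← lift_inducedAct, h2] at this
    convert this using 2
    · ext1 <;> simp [← comp_lift]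
    · ext1 <;> simp)
  refine ⟨k, fun T' t x z ↦ ?_⟩
  rw [← hk, lift_whiskerLeft_assoc]

lemma exists_smul (hq : IsFnEqualizer (inducedAct α P) (snd G (P.X ⊗ G₁)) q) :
    ∃ m : G₁ ⊗ Q ⟶ Q, ∀ (T : Over (Spec (.of K))) (z' : T ⟶ G₁) (x : T ⟶ P.X)
    (z : T ⟶ G₁), lift z' (lift x z ≫ q) ≫ m = lift x (z' * z) ≫ q := by
  have h0 (T : Over (Spec (.of K))) (z' : T ⟶ G₁) (x : T ⟶ P.X) (z : T ⟶ G₁) :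
      lift z' (lift x z) ≫ lift (snd G₁ (P.X ⊗ G₁) ≫ fst _ _) (fst _ _ * (snd _ _ ≫ snd _ _)) ≫ q =
        lift x (z' * z) ≫ q := by
    rw [comp_lift_assoc, MonObj.comp_mul]
    simp
  -- Left translation by `z'` commutes with the right translation by `α(c)` through which `G` acts
  -- on `G₁`, so `q(x, z' * z)` is invariant.
  obtain ⟨m, hm⟩ := hq.exists_lift_comp (T := G₁) (W := Q)
    (lift (snd _ _ ≫ fst _ _) (fst _ _ * (snd _ _ ≫ snd _ _)) ≫ q) (fun T z' c x z ↦ by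
      rw [h0, h0, ← mul_assoc, ← lift_smul_comp_of_inducedAct_comp hq.condition, smul_inv_smul])
  exact ⟨m, fun T z' x z ↦ (hm T z' x z).trans (h0 T z' x z)⟩

lemma exists_modObj (hq : IsFnEqualizer (inducedAct α P) (snd G (P.X ⊗ G₁)) q) :
    ∃ _ : ModObj G₁ Q, ∀ (T : Over (Spec (.of K))) (z' : T ⟶ G₁) (x : T ⟶ P.X)
    (z : T ⟶ G₁), z' • (lift x z ≫ q) = lift x (z' * z) ≫ q := by
  obtain ⟨m, hm⟩ := hq.exists_smul
  have : IsAffine (𝟙_ (Over (Spec (.of K)))).left := inferInstanceAs (IsAffine (Spec (.of K)))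
  have h1 : η[G₁] ▷ Q ≫ m = (λ_ Q).hom := by
    refine hq.hom_ext_of_lift fun T t x z ↦ ?_
    have ht : t ≫ η[G₁] = 1 := congrArg (· ≫ η[G₁]) (toUnit_unique _ _)
    rw [lift_whiskerRight_assoc, ht, hm, one_mul, lift_leftUnitor_hom]
  have h2 : μ[G₁] ▷ Q ≫ m = (α_ G₁ G₁ Q).hom ≫ G₁ ◁ m ≫ m := by
    refine hq.hom_ext_of_lift fun T t x z ↦ ?_
    obtain ⟨t₁, t₂, rfl⟩ : ∃ t₁ t₂, t = lift t₁ t₂ := ⟨t ≫ fst _ _, t ≫ snd _ _, by simp⟩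
    rw [lift_whiskerRight_assoc, ← Hom.mul_def, hm, lift_lift_associator_hom_assoc,
      lift_whiskerLeft_assoc, hm, hm, mul_assoc]
  exact ⟨{ smul := m, one_smul := h1, mul_smul := h2 }, hm⟩

/-- The value is forced: `c(x, y)` should carry `f(x) = q(x, 1)` to `y = q(x', z) = z • f(x')`, and
`f(x') = α(g) • f(x)` if `x' = g • x`. The formula descends because replacing `x'` by `g⁻¹ • x'`
multiplies the difference by `g⁻¹` on the left, which cancels the factor `α(g)` acquired by `z`. -/
lemma exists_diff [IsMonHom α] (hq : IsFnEqualizer (inducedAct α P) (snd G (P.X ⊗ G₁)) q) :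
    ∃ c : P.X ⊗ Q ⟶ G₁, ∀ (T : Over (Spec (.of K))) (x x' : T ⟶ P.X)
    (z : T ⟶ G₁), lift x (lift x' z ≫ q) ≫ c = z * (P.diff x' x ≫ α) := by
  have h0 (T : Over (Spec (.of K))) (x x' : T ⟶ P.X) (z : T ⟶ G₁) :
      lift x (lift x' z) ≫ ((snd P.X (P.X ⊗ G₁) ≫ snd _ _) *
        (P.diff (snd P.X (P.X ⊗ G₁) ≫ fst _ _) (fst _ _) ≫ α)) = z * (P.diff x' x ≫ α) := by
    rw [MonObj.comp_mul, ← Category.assoc _ _ α, P.comp_diff']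
    simp
  obtain ⟨c, hc⟩ := hq.exists_lift_comp (T := P.X) (W := G₁)
    ((snd P.X (P.X ⊗ G₁) ≫ snd _ _) * (P.diff (snd P.X (P.X ⊗ G₁) ≫ fst _ _) (fst _ _) ≫ α))
    (fun T x g x' z ↦ by
      rw [h0, h0]
      have : P.diff (g⁻¹ • x') x = g⁻¹ * P.diff x' x := by
        rw [P.diff_eq_iff, mul_smul, P.diff_smul]
      rw [this, MonObj.mul_comp, GrpObj.inv_comp, mul_assoc, mul_inv_cancel_left])
  exact ⟨c, fun T x x' z ↦ (hc T x x' z).trans (h0 T x x' z)⟩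

end IsFnEqualizer

/-! ### Descent of the torsor axioms along `P ⟶ Spec K` -/

section Descent

variable [IsAffine P.X.left] [ModObj G₁ Q] {f : P.X ⟶ Q} {c : P.X ⊗ Q ⟶ G₁}

/-- The projection `P × Z ⟶ Z` is flat, surjective and quasi-compact, and being an isomorphism
descends along such morphisms. -/
lemma isIso_of_isIso_whiskerLeft (P : Torsor G) [IsAffine P.X.left] {Y Z : Over (Spec (.of K))}
    (m : Y ⟶ Z) [IsIso (P.X ◁ m)] : IsIso m := by
  have h0 : IsPullback (snd P.X Z).left (fst P.X Z).left Z.hom P.X.hom :=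
    (IsPullback.of_hasPullback P.X.hom Z.hom).flip
  have := P.surjective
  have := P.flat
  have h1 : (@Surjective ⊓ @Flat ⊓ @QuasiCompact : MorphismProperty Scheme.{u}) (snd P.X Z).left :=
    ⟨⟨MorphismProperty.of_isPullback h0.flip P.surjective,
      MorphismProperty.of_isPullback h0.flip P.flat⟩,
      MorphismProperty.of_isPullback (P := @QuasiCompact) h0.flip inferInstance⟩
  have h2 : IsIso (P.X ◁ m).left := inferInstanceAs (IsIso ((Over.forget _).map (P.X ◁ m)))
  have h3 : IsIso m.left := MorphismProperty.of_isPullback_of_descendsAlong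
    (P := .isomorphisms Scheme.{u}) (isPullback_whiskerLeft P.X m) h1 h2
  have : IsIso ((Over.forget _).map m) := h3
  exact isIso_of_reflects_iso m (Over.forget _)

/-- The isomorphism `P × Q ≅ P × G₁`, `(x, y) ↦ (x, c(x, y))`. -/
noncomputable def trivializationIso
    (h1 : ∀ (T : Over (Spec (.of K))) (x : T ⟶ P.X) (y : T ⟶ Q), (lift x y ≫ c) • (x ≫ f) = y)
    (h2 : ∀ (T : Over (Spec (.of K))) (x : T ⟶ P.X) (z : T ⟶ G₁),
      lift x (z • (x ≫ f)) ≫ c = z) : P.X ⊗ Q ≅ P.X ⊗ G₁ where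
  hom := lift (fst _ _) c
  inv := lift (fst _ _) (snd P.X G₁ • (fst P.X G₁ ≫ f))
  hom_inv_id := by
    have := h1 _ (fst P.X Q) (snd P.X Q)
    rw [lift_fst_snd, Category.id_comp] at this
    ext1
    · simp
    · simp [ModObj.comp_smul, this]
  inv_hom_id := by
    ext1
    · simp
    · simp [h2]

/-- An action of `G₁` on `Q` for which there is a function `c` on `P × Q` with
`y = c(x, y) • f(x)` and `c(x, z • f(x)) = z` is simply transitive. -/
lemma isIso_leftSMul_of_diff
    (h1 : ∀ (T : Over (Spec (.of K))) (x : T ⟶ P.X) (y : T ⟶ Q), (lift x y ≫ c) • (x ≫ f) = y)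
    (h2 : ∀ (T : Over (Spec (.of K))) (x : T ⟶ P.X) (z : T ⟶ G₁),
      lift x (z • (x ≫ f)) ≫ c = z) : IsIso (ModObj.leftSMul G₁ Q) := by
  have h3 (T : Over (Spec (.of K))) (x : T ⟶ P.X) (g : T ⟶ G₁) (y : T ⟶ Q) :
      lift x (g • y) ≫ c = g * (lift x y ≫ c) := by
    conv_lhs => rw [← h1 T x y, ← mul_smul, h2]
  have hl : P.X ◁ ModObj.leftSMul G₁ Q = lift (fst _ _)
      (lift ((snd P.X (G₁ ⊗ Q) ≫ fst _ _) • (snd P.X (G₁ ⊗ Q) ≫ snd _ _))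
        (snd P.X (G₁ ⊗ Q) ≫ snd _ _)) := by
    rw [← ModObj.lift_leftSMul, ← comp_lift, lift_fst_snd, Category.comp_id]
    ext1 <;> simp
  have : IsIso (P.X ◁ ModObj.leftSMul G₁ Q) := by
    -- Over `P`, the inverse is `(x, y, y') ↦ (x, c(x, y) * c(x, y')⁻¹, y')`: both `y` and `y'` are
    -- compared with the base point `f(x)`.
    refine ⟨lift (fst _ _) (lift ((lift (fst _ _) (snd P.X (Q ⊗ Q) ≫ fst _ _) ≫ c) *
      (lift (fst _ _) (snd P.X (Q ⊗ Q) ≫ snd _ _) ≫ c)⁻¹) (snd P.X (Q ⊗ Q) ≫ snd _ _)), ?_, ?_⟩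
    · rw [hl]
      ext1
      · simp
      · ext1
        · simp only [comp_lift, lift_fst, lift_snd,
            MonObj.comp_mul, GrpObj.comp_inv, ← Category.assoc, h3]
          simp
        · simp
    · rw [hl]
      ext1
      · simp
      · have h4 := h1 _ (fst P.X (Q ⊗ Q)) (snd P.X (Q ⊗ Q) ≫ fst _ _)
        have h5 := h1 _ (fst P.X (Q ⊗ Q)) (snd P.X (Q ⊗ Q) ≫ snd _ _)
        ext1
        · simp only [comp_lift, lift_fst, lift_snd, lift_snd_assoc,
            ModObj.comp_smul]
          rw [mul_smul, inv_smul_eq_iff.2 h5.symm, h4]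
          simp
        · simp
  exact isIso_of_isIso_whiskerLeft P _

lemma surjective_hom_of_grpObj (G : Over (Spec (.of K))) [GrpObj G] : Surjective G.hom := by
  refine ⟨fun x ↦ ⟨η[G].left x, ?_⟩⟩
  rw [← Scheme.Hom.comp_apply, Over.w]
  rfl

/-- After base change to `P`, `Q` becomes isomorphic to `G₁`, so properties of `G₁` over `K` that
are stable under base change and descend pass to `Q`. -/
lemma property_hom_of_diff
    (h1 : ∀ (T : Over (Spec (.of K))) (x : T ⟶ P.X) (y : T ⟶ Q), (lift x y ≫ c) • (x ≫ f) = y)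
    (h2 : ∀ (T : Over (Spec (.of K))) (x : T ⟶ P.X) (z : T ⟶ G₁),
      lift x (z • (x ≫ f)) ≫ c = z) (W : MorphismProperty Scheme.{u}) [W.IsStableUnderBaseChange]
    [W.DescendsAlong (@Surjective ⊓ @Flat ⊓ @QuasiCompact)] (hW : W G₁.hom) : W Q.hom := by
  refine MorphismProperty.of_isPullback_of_descendsAlong
    (Q := (@Surjective ⊓ @Flat ⊓ @QuasiCompact : MorphismProperty Scheme.{u}))
    (IsPullback.of_hasPullback P.X.hom Q.hom)
    ⟨⟨P.surjective, P.flat⟩, (inferInstance : QuasiCompact P.X.hom)⟩ ?_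
  have h3 : W (fst P.X G₁).left :=
    W.of_isPullback (IsPullback.of_hasPullback P.X.hom G₁.hom).flip hW
  let e : (P.X ⊗ Q).left ≅ (P.X ⊗ G₁).left := (Over.forget _).mapIso (trivializationIso h1 h2)
  have h4 : (fst P.X Q).left = e.hom ≫ (fst P.X G₁).left := by
    refine congrArg (fun t ↦ t.left) (?_ : fst P.X Q = (trivializationIso h1 h2).hom ≫ fst P.X G₁)
    simp [trivializationIso]
  change W (fst P.X Q).left
  rw [h4]
  exact (W.cancel_left_of_respectsIso _ _).2 h3

end Descent

/-- For every `G`-torsor `P` there is a `G₁`-torsor induced from `P` along `α`. -/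
lemma exists_isEquivariant [IsAffine G.left] [IsAffine G₁.left] (α : G ⟶ G₁) [IsMonHom α]
    [LocallyOfFinitePresentation G₁.hom] (P : Torsor G) [IsAffine P.X.left] :
    ∃ (Q : Torsor G₁) (f : P.X ⟶ Q.X), IsEquivariant α f := by
  -- `Q` is the spectrum of the functions on `P × G₁` invariant under `G`; the equivariant morphism
  -- will be `f(x) = q(x, 1)`.
  obtain ⟨Q, _, q, hq⟩ := exists_isFnEqualizer (inducedAct α P) (snd G (P.X ⊗ G₁))
  obtain ⟨_, hm⟩ := hq.exists_modObj
  obtain ⟨c, hc⟩ := hq.exists_diff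
  have hf (T : Over (Spec (.of K))) (x : T ⟶ P.X) : x ≫ lift (𝟙 _) 1 ≫ q = lift x 1 ≫ q := by
    rw [comp_lift_assoc, Category.comp_id, MonObj.comp_one]
  have hfq (T : Over (Spec (.of K))) (x : T ⟶ P.X) (z : T ⟶ G₁) :
      z • (x ≫ lift (𝟙 _) 1 ≫ q) = lift x z ≫ q := by
    rw [hf, hm, mul_one]
  have hfe (T : Over (Spec (.of K))) (g : T ⟶ G) (x : T ⟶ P.X) :
      (g • x) ≫ lift (𝟙 _) 1 ≫ q = (g ≫ α) • (x ≫ lift (𝟙 _) 1 ≫ q) := by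
    rw [hfq, hf, lift_smul_comp_of_inducedAct_comp hq.condition, one_mul]
  -- On `y = q(x', z)` with `x' = g • x`, this reads `z • α(g) • f(x) = z • f(x') = q(x', z)`.
  have h1 : c • (fst P.X Q ≫ lift (𝟙 _) 1 ≫ q) = snd P.X Q := by
    refine hq.hom_ext_of_lift fun T t x z ↦ ?_
    rw [ModObj.comp_smul, hc, lift_snd, lift_fst_assoc, mul_smul, ← hfe, P.diff_smul, hfq]
  have h2 (T : Over (Spec (.of K))) (x : T ⟶ P.X) (y : T ⟶ Q) :
      (lift x y ≫ c) • (x ≫ lift (𝟙 _) 1 ≫ q) = y := by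
    have := congrArg (lift x y ≫ ·) h1
    simp only [ModObj.comp_smul, lift_snd, lift_fst_assoc] at this
    exact this
  have h3 (T : Over (Spec (.of K))) (x : T ⟶ P.X) (z : T ⟶ G₁) :
      lift x (z • (x ≫ lift (𝟙 _) 1 ≫ q)) ≫ c = z := by
    have : P.diff x x = 1 := by rw [P.diff_eq_iff, one_smul]
    rw [hfq, hc, this, MonObj.one_comp, mul_one]
  -- The base is the spectrum of a field, hence a single point; flatness of `Q` over it is
  -- automatic.
  have hS : Subsingleton (Spec (.of K)) := inferInstanceAs (Subsingleton (PrimeSpectrum K))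
  exact ⟨⟨Q, inferInstance, property_hom_of_diff h2 h3 @Surjective (surjective_hom_of_grpObj G₁),
    property_hom_of_diff h2 h3 @LocallyOfFinitePresentation inferInstance,
    isIso_leftSMul_of_diff h2 h3⟩, lift (𝟙 _) 1 ≫ q, hfe⟩

end Existence

/-! ### The induced map on `H¹` and the main theorem -/

lemma isMonHom_of_comp_mono {C : Type*} [Category* C] [MonoidalCategory C] {M N N' : C} [MonObj M]
    [MonObj N] [MonObj N'] (f : M ⟶ N) (i : N ⟶ N') [IsMonHom i] [Mono i]
    (h : IsMonHom (f ≫ i)) : IsMonHom f where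
  one_hom := by
    rw [← cancel_mono i, Category.assoc, IsMonHom.one_hom i, IsMonHom.one_hom (f ≫ i)]
  mul_hom := by
    rw [← cancel_mono i, Category.assoc, IsMonHom.mul_hom (f ≫ i), Category.assoc,
      IsMonHom.mul_hom i, ← Category.assoc, tensorHom_comp_tensorHom]

variable (p : ℕ) [Fact p.Prime] {K : Type u} [Field K] [CharP K p]
  {G G₁ : Over (Spec (.of K))} [GrpObj G] [GrpObj G₁] [IsHeightOne p G] [IsHeightOne p G₁]

lemma IsHeightOne.isAffine (G : Over (Spec (.of K))) [GrpObj G] [h : IsHeightOne p G] :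
    IsAffine G.left :=
  have := h.finite
  isAffine_of_isAffineHom G.hom

lemma IsHeightOne.locallyOfFinitePresentation (G : Over (Spec (.of K))) [GrpObj G]
    [h : IsHeightOne p G] : LocallyOfFinitePresentation G.hom :=
  have := h.finite
  inferInstance

/-- The map on isomorphism classes of torsors induced by a homomorphism of group schemes of height
one, and its compatibility with `Φ`. -/
lemma exists_inducedMap (k₀ : Type u) [CommRing k₀] [Algebra k₀ K] (α : G ⟶ G₁) [IsMonHom α] :
    ∃ aStar : H1 G → H1 G₁,
      (∀ P Q, aStar P.cls = Q.cls ↔ IsInduced α P Q) ∧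
      ∀ (P : H1 G) (w : frobOmega p G₁),
        Phi p k₀ (aStar P) w = Phi p k₀ P (frobOmegaMap p α w) := by
  have := IsHeightOne.isAffine p G
  have := IsHeightOne.isAffine p G₁
  have := IsHeightOne.locallyOfFinitePresentation p G₁
  have h (P : Torsor G) : ∃ (Q : Torsor G₁) (f : P.X ⟶ Q.X), IsEquivariant α f :=
    have := P.isAffine p
    exists_isEquivariant α P
  choose Q f hf using h
  refine ⟨Quotient.lift (fun P ↦ (Q P).cls) fun P P' ⟨e, he⟩ ↦ ?_,
    fun P Q' ↦ ⟨fun h ↦ ?_, fun h ↦ ?_⟩, fun P w ↦ ?_⟩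
  -- Composing with `P ≅ P'` makes both chosen torsors targets of equivariant morphisms from the
  -- same `P`, so they are isomorphic and the class does not depend on the representative.
  · refine Quotient.sound (equiv_of_isEquivariant (hf P) (f' := e.hom ≫ f P') ?_)
    intro T g x
    rw [← Category.assoc, IsModHom.map_smul, hf, Category.assoc]
  · obtain ⟨e, he⟩ := Quotient.exact h
    refine isInduced_of_isEquivariant (f := f P ≫ e.hom) fun T g x ↦ ?_
    rw [← Category.assoc, hf, IsModHom.map_smul, Category.assoc]
  · obtain ⟨f', hf'⟩ := h.exists_isEquivariant
    exact Quotient.sound (equiv_of_isEquivariant (hf P) hf')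
  · induction P using Quotient.inductionOn with
    | h P => exact Torsor.Phi_of_isEquivariant p k₀ (hf P) w

end HeightOne

theorem mainTheorem8 {k₀ : Type u} [Field k₀] [PerfectField k₀] (p : ℕ) [Fact p.Prime]
    [CharP k₀ p] (V : Over (Spec (.of k₀))) [IsIntegral V.left] (hV : Smooth V.hom)
    (hV' : IsQuasiProjective V) (𝒜 ℬ 𝒜₁ ℬ₁ : Over V.left)
    [GrpObj 𝒜] [GrpObj ℬ] [GrpObj 𝒜₁] [GrpObj ℬ₁]
    (h𝒜 : IsSemiabelian 𝒜) (hℬ : IsSemiabelian ℬ) (h𝒜₁ : IsSemiabelian 𝒜₁)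
    (hℬ₁ : IsSemiabelian ℬ₁)
    (ι₀ : 𝒜 ⟶ ℬ) [IsMonHom ι₀] [IsHeightOneIsogeny p ι₀]
    (ι₁ : 𝒜₁ ⟶ ℬ₁) [IsMonHom ι₁] [IsHeightOneIsogeny p ι₁]
    (a : 𝒜 ⟶ 𝒜₁) [IsMonHom a] (b : ℬ ⟶ ℬ₁) [IsMonHom b] (hab : ι₀ ≫ b = a ≫ ι₁) :
    ∃ (α : ker ι₀ ⟶ ker ι₁) (_ : IsMonHom α), α ≫ kerι ι₁ = kerι ι₀ ≫ a ∧
      ∃ aStar : H1 ((genericFibre V).obj (ker ι₀)) → H1 ((genericFibre V).obj (ker ι₁)),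
        (∀ P Q, aStar P.cls = Q.cls ↔ IsInduced ((genericFibre V).map α) P Q) ∧
        ∀ (P : H1 ((genericFibre V).obj (ker ι₀)))
          (w : frobOmega p ((genericFibre V).obj (ker ι₁))),
          Phi p k₀ (aStar P) w = Phi p k₀ P (frobOmegaMap p ((genericFibre V).map α) w) := by
  have hα : (kerι ι₀ ≫ a) ≫ ι₁ = 1 := by
    rw [Category.assoc, ← hab, kerι_comp_assoc, MonObj.one_comp]
  let α : ker ι₀ ⟶ ker ι₁ := kerLift ι₁ (kerι ι₀ ≫ a) hα
  have hαι : α ≫ kerι ι₁ = kerι ι₀ ≫ a := kerLift_ι _ _ _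
  -- Multiplicativity can be tested after the monomorphism `kerι ι₁`, where `α` becomes the
  -- restriction of `a`.
  have : IsMonHom α := isMonHom_of_comp_mono α (kerι ι₁) (by rw [hαι]; infer_instance)
  exact ⟨α, this, hαι, exists_inducedMap p k₀ ((genericFibre V).map α)⟩
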